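/- Let $\Bbbk$ be a field of characteristic $0$, let $q_{ij}\in\Bbbk^\times$ for $i,j\in\{1,2\}$, and let $V$ be the braided vector space with basis $x_1,x_2$ and diagonal braiding $c(x_i\otimes x_j)=q_{ij}\,x_j\otimes x_i$. Let $T(V)$ be the tensor algebra, $\mathfrak B(V)$ the Nichols algebra of $V$ (the quotient of $T(V)$ by the sum of all two-sided ideals that are generated by homogeneous elements of degree at least $2$ and are coideals for the braided comultiplication of $T(V)$ in which $x_1,x_2$ are primitive), and $\pi:T(V)\to\mathfrak B(V)$ the canonical map. Let $\chi$ be the bicharacter on $\mathbb Z^2$ with $\chi(\alpha_i,\alpha_j)=q_{ij}$, where $\alpha_1,\alpha_2$ is the standard basis of $\mathbb Z^2$ and $\deg x_i=\alpha_i$, and let $\operatorname{ad}x_1$ be the linear endomorphism of $T(V)$ with $(\operatorname{ad}x_1)(y)=x_1y-\chi(\alpha_1,\deg y)\,y\,x_1$ for homogeneous $y$. Put $q=q_{11}$, $r=q_{12}q_{21}$, $s=q_{22}$, and for $k\in\mathbb N_0$ $$(k)_q=\sum_{i=0}^{k-1}q^i,\qquad (k)_q^!=\prod_{i=1}^k (i)_q,\qquad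 b_k=\prod_{j=0}^{k-1}(1-q^jr).$$ Define $u_k\in T(V)$ by $u_0=x_2$ and $u_k=x_1u_{k-1}-q^{k-1}q_{12}\,u_{k-1}x_1$ for $k\ge1$, and let $U_m$ be the span of the products $u_iu_{m-i}$, $0\le i\le m$. For $k$ with $(k)_q^!b_k\neq0$ put $$\hat u_k=\frac{1}{(k)_q^!\,b_k}\,u_k,\qquad P_k=\sum_{i=0}^k(-q_{21})^i q^{i(i-1)/2}\,\hat u_i\,\hat u_{k-i}.$$ Let $\mathbb J\subseteq\mathbb N_0$ be the set defined recursively by: $j\in\mathbb J$ if and only if $q^{j(j-1)/2}(-r)^js=-1$ and $q^{j+n-1}r^2\neq1$ for all $n\in\mathbb J$ with $n<j$. Theorem. Let $m\in\mathbb N_0$ with $(m)_q^!\,b_m\neq0$. Then the elements $(\operatorname{ad}x_1)^{m-j}(P_j)$ with $j\in\mathbb J\cap[0,m]$ form a basis of $\ker(\pi)\cap U_m$. -/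

import Mathlib

open scoped TensorProduct

noncomputable section

namespace RankTwoNichols

/-! ### Nichols algebras of diagonal type -/

section Nichols

variable {K : Type*} [Field K] {I : Type*}

/-- The tensor algebra `T(V)` of a vector space `V` with basis `(x_i)_{i ∈ I}`, realized as the free
algebra on the letters `x_i = FreeAlgebra.ι K i`. -/
abbrev TV (K : Type*) [Field K] (I : Type*) : Type _ := FreeAlgebra K I

/-- The component `V^{⊗ n}` of `T(V)` of total degree `n`. -/
def homog (K : Type*) [Field K] (I : Type*) (n : ℕ) : Submodule K (TV K I) :=
  (Submodule.span K (Set.range (FreeAlgebra.ι K : I → TV K I))) ^ n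

/-- The algebra automorphism `x_j ↦ q_{ij} x_j` of `T(V)`. On a homogeneous element `y` of degree
`α ∈ ℕ₀^I` it is multiplication by `χ(α_i, α)`, where `χ` is the bicharacter with
`χ(α_i, α_j) = q_{ij}`; so the braiding is `c(x_i ⊗ y) = twist i y ⊗ x_i`. -/
def twist (Q : I → I → Kˣ) (i : I) : TV K I →ₐ[K] TV K I :=
  FreeAlgebra.lift K (fun j => (Q i j : K) • FreeAlgebra.ι K j)

/-- Left multiplication by `x_i ⊗ 1 + 1 ⊗ x_i` in the braided tensor product algebra
`T(V) ⊗ T(V)`: `u ⊗ v ↦ x_i u ⊗ v + χ(α_i, deg u) u ⊗ x_i v`. -/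
def primMul (Q : I → I → Kˣ) (i : I) : Module.End K (TV K I ⊗[K] TV K I) :=
  TensorProduct.map (LinearMap.mulLeft K (FreeAlgebra.ι K i)) LinearMap.id
    + TensorProduct.map (twist Q i).toLinearMap (LinearMap.mulLeft K (FreeAlgebra.ι K i))

/-- The braided comultiplication of `T(V)`: the algebra map from `T(V)` to the braided tensor
product algebra `T(V) ⊗ T(V)` with `Δ(x_i) = x_i ⊗ 1 + 1 ⊗ x_i`. Thus `Δ(1) = 1 ⊗ 1` and
`Δ(x_i y) = (x_i ⊗ 1 + 1 ⊗ x_i) Δ(y)`. -/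
def comul (Q : I → I → Kˣ) : TV K I →ₗ[K] TV K I ⊗[K] TV K I :=
  (LinearMap.applyₗ ((1 : TV K I) ⊗ₜ[K] (1 : TV K I))).comp
    (FreeAlgebra.lift K (primMul Q)).toLinearMap

/-- A two-sided ideal of `T(V)`, as a subspace. -/
def idealSubspace (J : TwoSidedIdeal (TV K I)) : Submodule K (TV K I) :=
  (TwoSidedIdeal.asIdeal J).restrictScalars K

/-- `Δ(J) ⊆ J ⊗ T(V) + T(V) ⊗ J`. -/
def IsCoideal (Q : I → I → Kˣ) (J : TwoSidedIdeal (TV K I)) : Prop :=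
  (idealSubspace J).map (comul Q) ≤
    LinearMap.range (TensorProduct.map (idealSubspace J).subtype
      (LinearMap.id : TV K I →ₗ[K] TV K I)) ⊔
    LinearMap.range (TensorProduct.map (LinearMap.id : TV K I →ₗ[K] TV K I)
      (idealSubspace J).subtype)

/-- The ideals `J` of `T(V)` that are generated by homogeneous elements of degree at least two
and are coideals. -/
def IsNicholsRelationIdeal (Q : I → I → Kˣ) (J : TwoSidedIdeal (TV K I)) : Prop :=
  (∃ S : Set (TV K I), (∀ x ∈ S, ∃ n : ℕ, 2 ≤ n ∧ x ∈ homog K I n) ∧ J = TwoSidedIdeal.span S) ∧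
    IsCoideal Q J

/-- The defining ideal of the Nichols algebra: the sum of all ideals of `T(V)` that are generated
by homogeneous elements of degree at least two and are coideals. -/
def nicholsIdeal (Q : I → I → Kˣ) : TwoSidedIdeal (TV K I) :=
  sSup {J | IsNicholsRelationIdeal Q J}

/-- The Nichols algebra of the braided vector space `V` of diagonal type with basis
`(x_i)_{i ∈ I}` and braiding `c(x_i ⊗ x_j) = q_{ij} x_j ⊗ x_i`. -/
abbrev NicholsAlgebra (Q : I → I → Kˣ) : Type _ := (nicholsIdeal Q).ringCon.Quotient

/-- The canonical map `π : T(V) → 𝔅(V)`. -/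
def nicholsProj (Q : I → I → Kˣ) : TV K I →ₐ[K] NicholsAlgebra Q :=
  RingCon.mkₐ K (nicholsIdeal Q).ringCon

/-- The adjoint action of the primitive element `x_i`:
`(ad x_i)(y) = x_i y - χ(α_i, deg y) y x_i` for homogeneous `y`. -/
def adj (Q : I → I → Kˣ) (i : I) : Module.End K (TV K I) :=
  LinearMap.mulLeft K (FreeAlgebra.ι K i)
    - (LinearMap.mulRight K (FreeAlgebra.ι K i)).comp (twist Q i).toLinearMap

end Nichols

/-! ### Quantum integers and the set `𝕁` -/

section Scalars

variable {K : Type*} [Field K]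

/-- `(m)_q = 1 + q + ⋯ + q^{m-1}`. -/
def qInt (q : K) (m : ℕ) : K := ∑ i ∈ Finset.range m, q ^ i

/-- `(m)_q^! = (1)_q (2)_q ⋯ (m)_q`. -/
def qFact (q : K) (m : ℕ) : K := ∏ i ∈ Finset.range m, qInt q (i + 1)

/-- `b_m = ∏_{j=0}^{m-1} (1 - q^j r)`. -/
def bCoef (q r : K) (m : ℕ) : K := ∏ j ∈ Finset.range m, (1 - q ^ j * r)

/-- Membership in `𝕁`, by recursion: `j ∈ 𝕁` if and only if `q^{j(j-1)/2} (-r)^j s = -1` and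
`q^{j+n-1} r² ≠ 1` for all `n ∈ 𝕁` with `n < j`. (Here `j + n - 1 ≥ 0` because `n < j`.) -/
def MemJ (q r s : K) (j : ℕ) : Prop :=
  q ^ (j * (j - 1) / 2) * (-r) ^ j * s = -1 ∧
    ∀ n : ℕ, ∀ _ : n < j, MemJ q r s n → q ^ (j + n - 1) * r ^ 2 ≠ 1
termination_by j

/-- The set `𝕁 = 𝕁_{q,r,s} ⊆ ℕ₀`. -/
def setJ (q r s : K) : Set ℕ := {j | MemJ q r s j}

theorem mem_setJ_iff (q r s : K) (j : ℕ) :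
    j ∈ setJ q r s ↔ q ^ (j * (j - 1) / 2) * (-r) ^ j * s = -1 ∧
      ∀ n ∈ setJ q r s, n < j → q ^ (j + n - 1) * r ^ 2 ≠ 1 := by
  change MemJ q r s j ↔ _
  rw [MemJ]
  exact and_congr_right fun _ => ⟨fun h n hn hj => h n hj hn, fun h n hj hn => h n hn hj⟩

end Scalars

/-! ### Rank two: the letters `x₁, x₂` are indexed by `0, 1 : Fin 2` -/

section RankTwo

variable {K : Type*} [Field K] (Q : Fin 2 → Fin 2 → Kˣ)

/-- `q = q₁₁`. -/
def parQ : K := (Q 0 0 : K)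

/-- `r = q₁₂ q₂₁`. -/
def parR : K := (Q 0 1 : K) * (Q 1 0 : K)

/-- `s = q₂₂`. -/
def parS : K := (Q 1 1 : K)

/-- `u_0 = x₂`, `u_{k+1} = x₁ u_k - q^k q₁₂ u_k x₁`. -/
def u : ℕ → TV K (Fin 2)
  | 0 => FreeAlgebra.ι K 1
  | k + 1 => FreeAlgebra.ι K 0 * u k
      - (parQ Q ^ k * (Q 0 1 : K)) • (u k * FreeAlgebra.ι K 0)

open Classical in
/-- The normalization `û_k = u_k / ((k)_q^! b_k)` if `(k)_q^! b_k ≠ 0`, and `0` otherwise. -/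
def uHat (k : ℕ) : TV K (Fin 2) :=
  if qFact (parQ Q) k * bCoef (parQ Q) (parR Q) k ≠ 0 then
    (qFact (parQ Q) k * bCoef (parQ Q) (parR Q) k)⁻¹ • u Q k
  else 0

/-- `P_k = ∑_{i=0}^k (-q₂₁)^i q^{i(i-1)/2} û_i û_{k-i}`; only used if `(k)_q^! b_k ≠ 0`. -/
def P (k : ℕ) : TV K (Fin 2) :=
  ∑ i ∈ Finset.range (k + 1),
    ((-(Q 1 0 : K)) ^ i * parQ Q ^ (i * (i - 1) / 2)) • (uHat Q i * uHat Q (k - i))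

/-- `U_n`, the span of the products `u_i u_{n-i}` with `0 ≤ i ≤ n`. -/
def U (n : ℕ) : Submodule K (TV K (Fin 2)) :=
  Submodule.span K {x | ∃ i ≤ n, x = u Q i * u Q (n - i)}

end RankTwo

end RankTwoNichols

end

noncomputable section

namespace RankTwoNichols

/-! ### Skew derivations of the tensor algebra -/

section Derivations

variable {K : Type*} [Field K] {I : Type*}

/-! The kernel of `π` is the set of elements annihilated by every functional "apply a word of skew
derivations, then the counit" (`derivNull`, `ker_nicholsProj`). This space is an ideal and a coideal
generated in degrees at least two. Every ideal competing in the definition is contained in it, being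
stable under the derivations and killed by the counit.

On the `U m` two operators act: the raising operator E = `adj Q 0` and the lowering operator F =
`leftDeriv Q 0`, both preserving `derivNull`. On `U m` they satisfy FE = qEF + (1 - q^(2m) r²), as
for quantum sl₂. The kernel of F on `U m` is the line through `P m`, so the P's are lowest weight
vectors and F E^(k+1) P_n = (k+1)_q (1 - q^(2n+k) r²) E^k P_n. An element of `U m` lies in
`derivNull` exactly when its image under F does and one scalar built from its two extreme
coordinates vanishes (`comb_mem_derivNull_iff`). For `P m` this scalar condition is the first
condition in the definition of 𝕁.

The basis is obtained by induction on m, lifting relations of degree m through F. A basis vector v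
of degree m has FEv = λv. If no λ is zero, each v lifts to a multiple of Ev, and the only possible
new relation is `P (m+1)`, present exactly when m+1 ∈ 𝕁. If λ = 0 for some v, that v is unique and
Ev is a nonzero multiple of `P (m+1)`. Hence m+1 ∉ 𝕁 although `P (m+1)` is a relation, and the count
is right only if v has no preimage under F among the relations.

That obstruction is the delicate point (`lowerSolve_ladder_ne_zero`). With r replaced by an
indeterminate, a preimage would force a double zero at r where a direct computation shows a simple
one. Characteristic 0 enters there only. -/

theorem freeAlgebra_left_induction {p : TV K I → Prop} (one : p 1)
    (add : ∀ a b, p a → p b → p (a + b)) (smul : ∀ (c : K) a, p a → p (c • a))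
    (mul : ∀ i a, p a → p (FreeAlgebra.ι K i * a)) (a : TV K I) : p a := by
  have key : ∀ a : TV K I, ∀ y, p y → p (a * y) := by
    intro a
    induction a using FreeAlgebra.induction with
    | grade0 r => intro y hy; rw [← Algebra.smul_def]; exact smul r y hy
    | grade1 x => exact fun y hy => mul x y hy
    | mul a b ha hb => intro y hy; rw [mul_assoc]; exact ha _ (hb _ hy)
    | add a b ha hb => intro y hy; rw [add_mul]; exact add _ _ (ha _ hy) (hb _ hy)
  simpa using key a 1 one

/-- The augmentation `T(V) → K` killing all letters. -/
def counit (K : Type*) [Field K] (I : Type*) : TV K I →ₐ[K] K :=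
  FreeAlgebra.lift K (fun _ => (0 : K))

@[simp] theorem counit_ι (i : I) : counit K I (FreeAlgebra.ι K i) = 0 := by
  simp [counit]

/-- The algebra automorphism `x_j ↦ q_{ji} x_j`. -/
def twistOp (Q : I → I → Kˣ) (i : I) : TV K I →ₐ[K] TV K I :=
  FreeAlgebra.lift K (fun j => (Q j i : K) • FreeAlgebra.ι K j)

variable (Q : I → I → Kˣ)

@[simp] theorem twist_ι (i j : I) :
    twist Q i (FreeAlgebra.ι K j) = (Q i j : K) • FreeAlgebra.ι K j := by
  simp [twist]

@[simp] theorem twistOp_ι (i j : I) :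
    twistOp Q i (FreeAlgebra.ι K j) = (Q j i : K) • FreeAlgebra.ι K j := by
  simp [twistOp]

@[simp] theorem counit_twist (i : I) (y : TV K I) : counit K I (twist Q i y) = counit K I y := by
  have : (counit K I).comp (twist Q i) = counit K I := by
    apply FreeAlgebra.hom_ext; funext j; simp
  exact DFunLike.congr_fun this y

theorem twist_twist_comm (i j : I) (y : TV K I) :
    twist Q i (twist Q j y) = twist Q j (twist Q i y) := by
  have : (twist Q i).comp (twist Q j) = (twist Q j).comp (twist Q i) := by
    apply FreeAlgebra.hom_ext; funext k; simp [smul_smul, mul_comm]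
  exact DFunLike.congr_fun this y

variable [DecidableEq I]

/-- The representation of `T(V)` by upper triangular matrices encoding `rightDeriv`. -/
def rightDerivHom (i : I) : TV K I →ₐ[K] Matrix (Fin 2) (Fin 2) (TV K I) :=
  FreeAlgebra.lift K (fun j =>
    !![FreeAlgebra.ι K j, if i = j then 1 else 0; 0, (Q i j : K) • FreeAlgebra.ι K j])

/-- The representation of `T(V)` by upper triangular matrices encoding `leftDeriv`. -/
def leftDerivHom (i : I) : TV K I →ₐ[K] Matrix (Fin 2) (Fin 2) (TV K I) :=
  FreeAlgebra.lift K (fun j =>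
    !![(Q j i : K) • FreeAlgebra.ι K j, if i = j then 1 else 0; 0, FreeAlgebra.ι K j])

/-- The skew derivation `∂_i` with `∂_i(x_j) = δ_{ij}` and
`∂_i(ab) = a ∂_i(b) + ∂_i(a) twist_i(b)`. -/
def rightDeriv (i : I) : TV K I →ₗ[K] TV K I where
  toFun a := rightDerivHom Q i a 0 1
  map_add' a b := by simp
  map_smul' c a := by simp

/-- The skew derivation with `∂'_i(x_j) = δ_{ij}` and
`∂'_i(ab) = ∂'_i(a) b + twistOp_i(a) ∂'_i(b)`. -/
def leftDeriv (i : I) : TV K I →ₗ[K] TV K I where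
  toFun a := leftDerivHom Q i a 0 1
  map_add' a b := by simp
  map_smul' c a := by simp

/-- The diagonal entries are the identity and the twist, so multiplicativity of the matrix
representation is the skew Leibniz rule for the corner entry. -/
theorem rightDerivHom_apply (i : I) (a : TV K I) :
    rightDerivHom Q i a = !![a, rightDeriv Q i a; 0, twist Q i a] := by
  have h : rightDerivHom Q i a 0 0 = a ∧ rightDerivHom Q i a 1 0 = 0 ∧
      rightDerivHom Q i a 1 1 = twist Q i a := by
    induction a using FreeAlgebra.induction with
    | grade0 r => simp [Matrix.algebraMap_eq_diagonal]
    | grade1 x => simp [rightDerivHom]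
    | mul a b ha hb => simp [Matrix.mul_apply, ha, hb]
    | add a b ha hb => simp [ha, hb]
  ext x y
  fin_cases x <;> fin_cases y <;> simp [h, rightDeriv]

theorem leftDerivHom_apply (i : I) (a : TV K I) :
    leftDerivHom Q i a = !![twistOp Q i a, leftDeriv Q i a; 0, a] := by
  have h : leftDerivHom Q i a 0 0 = twistOp Q i a ∧ leftDerivHom Q i a 1 0 = 0 ∧
      leftDerivHom Q i a 1 1 = a := by
    induction a using FreeAlgebra.induction with
    | grade0 r => simp [Matrix.algebraMap_eq_diagonal]
    | grade1 x => simp [leftDerivHom]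
    | mul a b ha hb => simp [Matrix.mul_apply, ha, hb]
    | add a b ha hb => simp [ha, hb]
  ext x y
  fin_cases x <;> fin_cases y <;> simp [h, leftDeriv]

theorem rightDeriv_mul (i : I) (a b : TV K I) :
    rightDeriv Q i (a * b) = a * rightDeriv Q i b + rightDeriv Q i a * twist Q i b := by
  change rightDerivHom Q i (a * b) 0 1 = _
  rw [map_mul, rightDerivHom_apply, rightDerivHom_apply]
  simp [Matrix.mul_apply]

theorem leftDeriv_mul (i : I) (a b : TV K I) :
    leftDeriv Q i (a * b) = leftDeriv Q i a * b + twistOp Q i a * leftDeriv Q i b := by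
  change leftDerivHom Q i (a * b) 0 1 = _
  rw [map_mul, leftDerivHom_apply, leftDerivHom_apply]
  simp [Matrix.mul_apply, add_comm]

@[simp] theorem rightDeriv_ι (i j : I) :
    rightDeriv Q i (FreeAlgebra.ι K j) = if i = j then 1 else 0 := by
  simp [rightDeriv, rightDerivHom]

@[simp] theorem leftDeriv_ι (i j : I) :
    leftDeriv Q i (FreeAlgebra.ι K j) = if i = j then 1 else 0 := by
  simp [leftDeriv, leftDerivHom]

@[simp] theorem rightDeriv_one (i : I) : rightDeriv Q i (1 : TV K I) = 0 := by
  simp [rightDeriv]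

@[simp] theorem leftDeriv_one (i : I) : leftDeriv Q i (1 : TV K I) = 0 := by
  simp [leftDeriv]

theorem rightDeriv_twist (i j : I) (y : TV K I) :
    rightDeriv Q i (twist Q j y) = (Q j i : K) • twist Q j (rightDeriv Q i y) := by
  induction y using freeAlgebra_left_induction with
  | one => simp
  | add a b ha hb => simp [ha, hb]
  | smul c a ha => simp [ha, smul_comm c]
  | mul k a ha =>
    simp only [map_mul, twist_ι, rightDeriv_mul, map_smul, rightDeriv_ι, map_add, ha,
      twist_twist_comm Q i j, smul_add, smul_mul_assoc, mul_smul_comm, smul_smul]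
    by_cases h : i = k
    · subst h; simp
    · simp [h, mul_comm]

theorem leftDeriv_twist (i j : I) (y : TV K I) :
    leftDeriv Q i (twist Q j y) = (Q j i : K) • twist Q j (leftDeriv Q i y) := by
  induction y using freeAlgebra_left_induction with
  | one => simp
  | add a b ha hb => simp [ha, hb]
  | smul c a ha => simp [ha, smul_comm c]
  | mul k a ha =>
    simp only [map_mul, twist_ι, leftDeriv_mul, map_smul, leftDeriv_ι, map_add, ha, twistOp_ι,
      smul_add, smul_mul_assoc, mul_smul_comm, smul_smul]
    by_cases h : i = k
    · subst h; simp [mul_comm, mul_left_comm]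
    · simp [h, mul_comm, mul_left_comm]

/-- The two kinds of derivations remove letters while passing from opposite ends of a word. This
lets `derivNull`, defined through `rightDeriv`, be tested with `leftDeriv`. -/
theorem leftDeriv_rightDeriv_comm (i j : I) (y : TV K I) :
    leftDeriv Q i (rightDeriv Q j y) = rightDeriv Q j (leftDeriv Q i y) := by
  induction y using freeAlgebra_left_induction with
  | one => simp
  | add a b ha hb => simp [ha, hb]
  | smul c a ha => simp [ha]
  | mul k a ha =>
    by_cases h : i = k <;> by_cases h' : j = k
    · subst h; subst h'
      simp [leftDeriv_mul, rightDeriv_mul, ha, leftDeriv_twist]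
      abel
    · subst h
      simp [leftDeriv_mul, rightDeriv_mul, ha, h']
    · subst h'
      simp [leftDeriv_mul, rightDeriv_mul, ha, h, leftDeriv_twist]
    · simp [leftDeriv_mul, rightDeriv_mul, ha, h, h']

theorem counit_leftDeriv (i : I) (y : TV K I) :
    counit K I (leftDeriv Q i y) = counit K I (rightDeriv Q i y) := by
  induction y using freeAlgebra_left_induction with
  | one => simp
  | add a b ha hb => simp [ha, hb]
  | smul c a ha => simp [ha]
  | mul k a ha =>
    by_cases h : i = k
    · subst h; simp [leftDeriv_mul, rightDeriv_mul]
    · simp [leftDeriv_mul, rightDeriv_mul, h]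

end Derivations

/-! ### The common kernel of the derivation functionals is an ideal and a coideal -/

section Coideal

variable {K : Type*} [Field K] {I : Type*} (Q : I → I → Kˣ)

@[simp] theorem comul_one : comul Q (1 : TV K I) = 1 ⊗ₜ[K] 1 := by
  simp [comul]

theorem comul_ι_mul (i : I) (y : TV K I) :
    comul Q (FreeAlgebra.ι K i * y) = primMul Q i (comul Q y) := by
  simp [comul]

@[simp] theorem primMul_tmul (i : I) (a b : TV K I) :
    primMul Q i (a ⊗ₜ[K] b) =
      (FreeAlgebra.ι K i * a) ⊗ₜ[K] b + twist Q i a ⊗ₜ[K] (FreeAlgebra.ι K i * b) := by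
  simp [primMul]

theorem comul_twist (i : I) (y : TV K I) :
    comul Q (twist Q i y) =
      TensorProduct.map (twist Q i).toLinearMap (twist Q i).toLinearMap (comul Q y) := by
  induction y using freeAlgebra_left_induction with
  | one => simp
  | add a b ha hb => simp [ha, hb]
  | smul c a ha => simp [ha]
  | mul k a ha =>
    simp only [map_mul, twist_ι, smul_mul_assoc, map_smul, comul_ι_mul, ha]
    generalize comul Q a = t
    induction t using TensorProduct.induction_on with
    | zero => simp
    | add x y hx hy => simp only [map_add, smul_add, hx, hy]
    | tmul a b =>
      simp [twist_twist_comm Q i k, smul_add, TensorProduct.smul_tmul']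

theorem mem_idealSubspace {J : TwoSidedIdeal (TV K I)} {y : TV K I} :
    y ∈ idealSubspace J ↔ y ∈ J := TwoSidedIdeal.mem_asIdeal

/-- Expanding the left factor in a basis reduces the claim to coordinates in `A`, where the
functionals separate points. -/
theorem eq_zero_of_forall_lTensor_eq_zero {A : Type*} [AddCommGroup A] [Module K A] {W : Type*}
    (f : W → A →ₗ[K] K) (hf : ∀ a, (∀ w, f w a = 0) → a = 0) {B : Type*} [AddCommGroup B]
    [Module K B] (t : B ⊗[K] A) (ht : ∀ w, (f w).lTensor B t = 0) : t = 0 := by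
  classical
  let b := Module.Basis.ofVectorSpace K B
  let e := TensorProduct.equivFinsuppOfBasisLeft (N := A) b
  have key : ∀ w i (t : B ⊗[K] A), f w (e t i) =
      TensorProduct.equivFinsuppOfBasisLeft (N := K) b ((f w).lTensor B t) i := by
    intro w i t
    induction t using TensorProduct.induction_on with
    | zero => simp
    | add x y hx hy => simp [hx, hy]
    | tmul x y => simp [e]
  apply e.injective
  ext i
  rw [map_zero, Finsupp.zero_apply]
  refine hf _ fun w => ?_
  rw [key, ht]
  simp

theorem rid_lTensor_counit_comul (y : TV K I) :
    TensorProduct.rid K (TV K I) ((counit K I).toLinearMap.lTensor (TV K I) (comul Q y)) = y := by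
  induction y using freeAlgebra_left_induction with
  | one => simp
  | add a b ha hb => simp only [map_add, ha, hb]
  | smul c a ha => simp only [map_smul, ha]
  | mul k a ha =>
    rw [comul_ι_mul]
    conv_rhs => rw [← ha]
    generalize comul Q a = t
    induction t using TensorProduct.induction_on with
    | zero => simp
    | add x y hx hy => simp only [map_add, hx, hy, mul_add]
    | tmul a b => simp

variable [DecidableEq I]

/-- Iterating this and then applying the counit recovers each word of derivations from the
comultiplication. This is the bridge between coideals and `derivNull`. -/
theorem lTensor_rightDeriv_comul (i : I) (y : TV K I) :
    (rightDeriv Q i).lTensor (TV K I) (comul Q y) = comul Q (rightDeriv Q i y) := by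
  induction y using freeAlgebra_left_induction with
  | one => simp
  | add a b ha hb => simp only [map_add, ha, hb]
  | smul c a ha => simp only [map_smul, ha]
  | mul k a ha =>
    have key : ∀ t : TV K I ⊗[K] TV K I, (rightDeriv Q i).lTensor (TV K I) (primMul Q k t) =
        primMul Q k ((rightDeriv Q i).lTensor (TV K I) t) + (if i = k then (1 : K) else 0) •
          TensorProduct.map (twist Q i).toLinearMap (twist Q i).toLinearMap t := by
      intro t
      induction t using TensorProduct.induction_on with
      | zero => simp
      | add x y hx hy => simp only [map_add, hx, hy, smul_add]; abel
      | tmul a b =>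
        by_cases h : i = k
        · subst h; simp [rightDeriv_mul, TensorProduct.tmul_add, add_assoc]
        · simp [rightDeriv_mul, h]
    rw [comul_ι_mul, key, ha, ← comul_twist, rightDeriv_mul, map_add, comul_ι_mul]
    by_cases h : i = k
    · subst h; simp
    · simp [h]

/-- The composition `∂_{w_n} ∘ ⋯ ∘ ∂_{w_1}`. -/
def wordDeriv : List I → (TV K I →ₗ[K] TV K I)
  | [] => LinearMap.id
  | i :: w => (wordDeriv w).comp (rightDeriv Q i)

/-- The functional `ε ∘ ∂_{w_n} ∘ ⋯ ∘ ∂_{w_1}`. -/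
def wordFunctional (w : List I) : TV K I →ₗ[K] K :=
  (counit K I).toLinearMap.comp (wordDeriv Q w)

theorem rid_lTensor_wordFunctional_comul (w : List I) (y : TV K I) :
    TensorProduct.rid K (TV K I) ((wordFunctional Q w).lTensor (TV K I) (comul Q y)) =
      wordDeriv Q w y := by
  induction w generalizing y with
  | nil => exact rid_lTensor_counit_comul Q y
  | cons i w ih =>
    have := ih (rightDeriv Q i y)
    rw [← lTensor_rightDeriv_comul, ← LinearMap.comp_apply, ← LinearMap.lTensor_comp] at this
    exact this

/-- The common kernel of all functionals `ε ∘ ∂_w`. -/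
def derivNull : Submodule K (TV K I) := ⨅ w : List I, LinearMap.ker (wordFunctional Q w)

variable {Q}

theorem mem_derivNull {y : TV K I} : y ∈ derivNull Q ↔ ∀ w, wordFunctional Q w y = 0 := by
  simp [derivNull]

theorem mem_derivNull_iff {y : TV K I} :
    y ∈ derivNull Q ↔ counit K I y = 0 ∧ ∀ i, rightDeriv Q i y ∈ derivNull Q := by
  simp only [mem_derivNull]
  refine ⟨fun h => ⟨h [], fun i w => h (i :: w)⟩, fun h w => ?_⟩
  cases w with
  | nil => exact h.1
  | cons i w => exact h.2 i w

/-- `derivNull` is the largest derivation-stable subspace in the kernel of the counit; the closure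
properties below all come from this maximality. -/
theorem le_derivNull {S : Submodule K (TV K I)} (h0 : ∀ y ∈ S, counit K I y = 0)
    (h : ∀ i, ∀ y ∈ S, rightDeriv Q i y ∈ S) : S ≤ derivNull Q := by
  have : ∀ w : List I, ∀ y ∈ S, wordFunctional Q w y = 0 := by
    intro w
    induction w with
    | nil => exact h0
    | cons i w ih => exact fun y hy => ih _ (h i y hy)
  exact fun y hy => mem_derivNull.2 fun w => this w y hy

theorem counit_of_mem_derivNull {y : TV K I} (hy : y ∈ derivNull Q) : counit K I y = 0 :=
  (mem_derivNull_iff.1 hy).1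

theorem rightDeriv_mem_derivNull {y : TV K I} (hy : y ∈ derivNull Q) (i : I) :
    rightDeriv Q i y ∈ derivNull Q :=
  (mem_derivNull_iff.1 hy).2 i

theorem wordDeriv_mem_derivNull {y : TV K I} (hy : y ∈ derivNull Q) (w : List I) :
    wordDeriv Q w y ∈ derivNull Q := by
  induction w generalizing y with
  | nil => exact hy
  | cons i w ih => exact ih (rightDeriv_mem_derivNull hy i)

theorem twist_mem_derivNull {y : TV K I} (hy : y ∈ derivNull Q) (i : I) :
    twist Q i y ∈ derivNull Q := by
  refine le_derivNull (Q := Q) (S := (derivNull Q).map (twist Q i).toLinearMap) ?_ ?_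
    ⟨y, hy, rfl⟩
  · rintro _ ⟨z, hz, rfl⟩
    simpa using counit_of_mem_derivNull hz
  · rintro j _ ⟨z, hz, rfl⟩
    refine ⟨(Q i j : K) • rightDeriv Q j z,
      Submodule.smul_mem _ _ (rightDeriv_mem_derivNull hz j), ?_⟩
    simp [rightDeriv_twist]

theorem mul_mul_mem_derivNull {y : TV K I} (hy : y ∈ derivNull Q) (a b : TV K I) :
    a * y * b ∈ derivNull Q := by
  refine le_derivNull (Q := Q)
    (S := Submodule.span K {z | ∃ a b, ∃ y ∈ derivNull Q, z = a * y * b}) ?_ ?_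
    (Submodule.subset_span ⟨a, b, y, hy, rfl⟩)
  · intro z hz
    induction hz using Submodule.span_induction with
    | mem z h => obtain ⟨a, b, y, hy, rfl⟩ := h; simp [counit_of_mem_derivNull hy]
    | zero => simp
    | add x y _ _ hx hy => simp [hx, hy]
    | smul c x _ hx => simp [hx]
  · intro i z hz
    induction hz using Submodule.span_induction with
    | mem z h =>
      obtain ⟨a, b, y, hy, rfl⟩ := h
      rw [mul_assoc, rightDeriv_mul, rightDeriv_mul, map_mul, mul_add, ← mul_assoc, ← mul_assoc,
        ← mul_assoc]
      refine Submodule.add_mem _ (Submodule.add_mem _ ?_ ?_) ?_ <;> apply Submodule.subset_span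
      · exact ⟨_, _, _, hy, rfl⟩
      · exact ⟨_, _, _, rightDeriv_mem_derivNull hy i, rfl⟩
      · exact ⟨_, _, _, twist_mem_derivNull hy i, rfl⟩
    | zero => simp
    | add x y _ _ hx hy => rw [map_add]; exact Submodule.add_mem _ hx hy
    | smul c x _ hx => rw [map_smul]; exact Submodule.smul_mem _ _ hx

theorem mul_mem_derivNull_left {y : TV K I} (hy : y ∈ derivNull Q) (a : TV K I) :
    a * y ∈ derivNull Q := by simpa using mul_mul_mem_derivNull hy a 1

theorem mul_mem_derivNull_right {y : TV K I} (hy : y ∈ derivNull Q) (b : TV K I) :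
    y * b ∈ derivNull Q := by simpa using mul_mul_mem_derivNull hy 1 b

theorem adj_mem_derivNull {y : TV K I} (hy : y ∈ derivNull Q) (i : I) :
    adj Q i y ∈ derivNull Q :=
  Submodule.sub_mem _ (mul_mem_derivNull_left hy _)
    (mul_mem_derivNull_right (twist_mem_derivNull hy i) _)

theorem counit_wordDeriv_leftDeriv (w : List I) (i : I) (y : TV K I) :
    counit K I (wordDeriv Q w (leftDeriv Q i y)) =
      counit K I (rightDeriv Q i (wordDeriv Q w y)) := by
  induction w generalizing y with
  | nil => exact counit_leftDeriv Q i y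
  | cons j w ih =>
    change counit K I (wordDeriv Q w (rightDeriv Q j (leftDeriv Q i y))) = _
    rw [← leftDeriv_rightDeriv_comm, ih]
    rfl

theorem wordDeriv_concat (w : List I) (i : I) (y : TV K I) :
    wordDeriv Q (w ++ [i]) y = rightDeriv Q i (wordDeriv Q w y) := by
  induction w generalizing y with
  | nil => rfl
  | cons j w ih => exact ih _

/-- By commutation, a left derivation can be moved past a word of right derivations. Under the
counit it then acts as a right derivation by the last letter. -/
theorem mem_derivNull_iff_left {y : TV K I} :
    y ∈ derivNull Q ↔ counit K I y = 0 ∧ ∀ i, leftDeriv Q i y ∈ derivNull Q := by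
  have key : ∀ w i, wordFunctional Q w (leftDeriv Q i y) = wordFunctional Q (w ++ [i]) y := by
    intro w i
    change counit K I (wordDeriv Q w (leftDeriv Q i y)) = counit K I (wordDeriv Q (w ++ [i]) y)
    rw [counit_wordDeriv_leftDeriv, wordDeriv_concat]
  simp only [mem_derivNull, key]
  refine ⟨fun h => ⟨h [], fun i w => h _⟩, fun h w => ?_⟩
  rcases List.eq_nil_or_concat w with rfl | ⟨w, i, rfl⟩
  · exact h.1
  · rw [List.concat_eq_append]; exact h.2 i w

variable (Q)

/-- `derivNull` as a two-sided ideal. -/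
def derivNullIdeal : TwoSidedIdeal (TV K I) :=
  TwoSidedIdeal.mk' (derivNull Q : Set (TV K I)) (Submodule.zero_mem _) (Submodule.add_mem _)
    (Submodule.neg_mem _) (fun h => mul_mem_derivNull_left h _)
    (fun h => mul_mem_derivNull_right h _)

variable {Q}

theorem mem_derivNullIdeal {y : TV K I} : y ∈ derivNullIdeal Q ↔ y ∈ derivNull Q :=
  TwoSidedIdeal.mem_mk' _ _ _ _ _ _ _

theorem idealSubspace_derivNullIdeal : idealSubspace (derivNullIdeal Q) = derivNull Q := by
  ext y; rw [mem_idealSubspace, mem_derivNullIdeal]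

theorem isCoideal_derivNullIdeal : IsCoideal Q (derivNullIdeal Q) := by
  rw [IsCoideal, idealSubspace_derivNullIdeal]
  rintro _ ⟨y, hy, rfl⟩
  set N := derivNull Q
  have hex : Function.Exact N.subtype N.mkQ := LinearMap.exact_subtype_mkQ N
  have hker := TensorProduct.map_ker hex N.mkQ_surjective hex N.mkQ_surjective
  -- The kernel of the tensor square of the quotient map is N ⊗ T + T ⊗ N. Vanishing in that tensor
  -- square is tested on the second factor by the word functionals, which separate points of T / N.
  -- Each test returns the class of a word derivative of `y`, which is zero.
  have hmem : comul Q y ∈ LinearMap.ker (TensorProduct.map N.mkQ N.mkQ) := by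
    rw [LinearMap.mem_ker]
    have hle : ∀ w, N ≤ LinearMap.ker (wordFunctional Q w) :=
      fun w z hz => mem_derivNull.1 hz w
    refine eq_zero_of_forall_lTensor_eq_zero (fun w => N.liftQ (wordFunctional Q w) (hle w)) ?_ _ ?_
    · intro a ha
      obtain ⟨a, rfl⟩ := N.mkQ_surjective a
      rw [Submodule.mkQ_apply, Submodule.Quotient.mk_eq_zero]
      exact mem_derivNull.2 fun w => ha w
    · intro w
      apply (TensorProduct.rid K _).injective
      rw [map_zero]
      have : ∀ t : TV K I ⊗[K] TV K I, TensorProduct.rid K (TV K I ⧸ N)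
          ((N.liftQ (wordFunctional Q w) (hle w)).lTensor _ (TensorProduct.map N.mkQ N.mkQ t)) =
          N.mkQ (TensorProduct.rid K (TV K I) ((wordFunctional Q w).lTensor (TV K I) t)) := by
        intro t
        induction t using TensorProduct.induction_on with
        | zero => simp
        | add x y hx hy => simp only [map_add, hx, hy]
        | tmul x y => simp
      rw [this, rid_lTensor_wordFunctional_comul, Submodule.mkQ_apply,
        Submodule.Quotient.mk_eq_zero]
      exact wordDeriv_mem_derivNull hy w
  rw [hker, sup_comm] at hmem
  exact hmem

end Coideal

/-! ### Degrees, and identification of the Nichols ideal -/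

section Grading

variable {K : Type*} [Field K] {I : Type*} (Q : I → I → Kˣ)

theorem homog_succ (n : ℕ) : homog K I (n + 1) = homog K I 1 * homog K I n := by
  rw [homog, homog, homog, pow_one, pow_succ']

theorem homog_zero : homog K I 0 = 1 := pow_zero _

theorem homog_one : homog K I 1 = Submodule.span K (Set.range (FreeAlgebra.ι K)) := pow_one _

theorem counit_of_mem_homog_succ {n : ℕ} {y : TV K I} (hy : y ∈ homog K I (n + 1)) :
    counit K I y = 0 := by
  rw [homog_succ] at hy
  induction hy using Submodule.mul_induction_on' with
  | add x _ y _ hx hy => simp [hx, hy]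
  | mem_mul_mem x hx y _ =>
    rw [homog_one] at hx
    have : counit K I x = 0 := by
      induction hx using Submodule.span_induction with
      | mem x h => obtain ⟨i, rfl⟩ := h; simp
      | zero => simp
      | add x y _ _ hx hy => simp [hx, hy]
      | smul c x _ hx => simp [hx]
    simp [this]

theorem twist_mem_homog {n : ℕ} {y : TV K I} (hy : y ∈ homog K I n) (i : I) :
    twist Q i y ∈ homog K I n := by
  have h1 : (homog K I 1).map (twist Q i).toLinearMap ≤ homog K I 1 := by
    rw [homog_one, Submodule.map_span_le]
    rintro _ ⟨j, rfl⟩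
    rw [AlgHom.toLinearMap_apply, twist_ι]
    exact Submodule.smul_mem _ _ (Submodule.subset_span (Set.mem_range_self j))
  have h : (homog K I n).map (twist Q i).toLinearMap ≤ homog K I n := by
    rw [homog, Submodule.map_pow]
    rw [homog_one] at h1
    exact pow_le_pow_left' h1 n
  exact h ⟨y, hy, rfl⟩

theorem iSup_homog : ⨆ n, homog K I n = ⊤ := by
  rw [eq_top_iff]
  rintro y -
  induction y using freeAlgebra_left_induction with
  | one =>
    refine Submodule.mem_iSup_of_mem 0 ?_
    rw [homog_zero]; exact Submodule.one_le.1 le_rfl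
  | add a b ha hb => exact Submodule.add_mem _ ha hb
  | smul c a ha => exact Submodule.smul_mem _ _ ha
  | mul i a ha =>
    induction ha using Submodule.iSup_induction' with
    | mem n x hx =>
      refine Submodule.mem_iSup_of_mem (n + 1) ?_
      rw [homog_succ]
      refine Submodule.mul_mem_mul ?_ hx
      rw [homog_one]
      exact Submodule.subset_span (Set.mem_range_self i)
    | zero => simp
    | add x y _ _ hx hy => rw [mul_add]; exact Submodule.add_mem _ hx hy

variable [DecidableEq I]

theorem rightDeriv_of_mem_homog_zero {y : TV K I} (hy : y ∈ homog K I 0) (i : I) :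
    rightDeriv Q i y = 0 := by
  rw [homog_zero, Submodule.mem_one] at hy
  obtain ⟨c, rfl⟩ := hy
  simp [Algebra.algebraMap_eq_smul_one]

theorem rightDeriv_mem_homog {n : ℕ} {y : TV K I} (hy : y ∈ homog K I (n + 1)) (i : I) :
    rightDeriv Q i y ∈ homog K I n := by
  have h1 : ∀ x ∈ homog K I 1, rightDeriv Q i x ∈ homog K I 0 := by
    intro x hx
    rw [homog_one] at hx
    induction hx using Submodule.span_induction with
    | mem x h =>
      obtain ⟨j, rfl⟩ := h
      rw [rightDeriv_ι]
      split_ifs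
      · rw [homog_zero]; exact Submodule.one_le.1 le_rfl
      · exact Submodule.zero_mem _
    | zero => simp
    | add x y _ _ hx hy => rw [map_add]; exact Submodule.add_mem _ hx hy
    | smul c x _ hx => rw [map_smul]; exact Submodule.smul_mem _ _ hx
  induction n generalizing y with
  | zero => exact h1 y hy
  | succ n ih =>
    rw [homog_succ] at hy
    induction hy using Submodule.mul_induction_on' with
    | add x _ y _ hx hy => rw [map_add]; exact Submodule.add_mem _ hx hy
    | mem_mul_mem x hx y hy =>
      rw [rightDeriv_mul]
      refine Submodule.add_mem _ ?_ ?_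
      · rw [homog_succ]; exact Submodule.mul_mem_mul hx (ih hy)
      · have := Submodule.mul_mem_mul (h1 x hx) (twist_mem_homog Q hy i)
        rwa [homog_zero, one_mul] at this

theorem wordFunctional_of_mem_homog (w : List I) {n : ℕ} {y : TV K I} (hy : y ∈ homog K I n)
    (h : w.length ≠ n) : wordFunctional Q w y = 0 := by
  induction w generalizing y n with
  | nil =>
    cases n with
    | zero => simp at h
    | succ n => exact counit_of_mem_homog_succ hy
  | cons i w ih =>
    change wordFunctional Q w (rightDeriv Q i y) = 0
    cases n with
    | zero => rw [rightDeriv_of_mem_homog_zero Q hy, map_zero]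
    | succ n => exact ih (rightDeriv_mem_homog Q hy i) (by simpa using h)

variable {Q}

theorem eq_zero_of_mem_homog_one {y : TV K I} (hy : y ∈ homog K I 1) (h : y ∈ derivNull Q) :
    y = 0 := by
  have key : y = ∑ᶠ i, counit K I (rightDeriv Q i y) • FreeAlgebra.ι K i := by
    rw [homog_one] at hy
    rw [← Set.image_univ, Finsupp.mem_span_image_iff_linearCombination] at hy
    obtain ⟨l, -, rfl⟩ := hy
    have : ∀ i, counit K I (rightDeriv Q i (Finsupp.linearCombination K (FreeAlgebra.ι K) l)) =
        l i := by
      intro i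
      rw [Finsupp.linearCombination_apply, Finsupp.sum, map_sum, map_sum]
      simp only [map_smul, rightDeriv_ι, apply_ite (counit K I), map_one, map_zero, smul_ite,
        smul_zero, smul_eq_mul, mul_one, Finset.sum_ite_eq]
      split_ifs with h0
      · rfl
      · exact (Finsupp.notMem_support_iff.1 h0).symm
    simp only [this]
    rw [Finsupp.linearCombination_apply, Finsupp.sum]
    refine (finsum_eq_sum_of_support_subset _ ?_).symm
    intro i hi
    simp only [Function.mem_support] at hi
    simp only [Finset.mem_coe, Finsupp.mem_support_iff]
    intro h0
    simp [h0] at hi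
  rw [key]
  simp [counit_of_mem_derivNull (rightDeriv_mem_derivNull h _)]

/-- A word functional sees only the component whose degree is the word length, so `derivNull` is
graded. Its components in degrees 0 and 1 vanish. -/
theorem derivNullIdeal_eq_span : derivNullIdeal Q =
    TwoSidedIdeal.span {y | (∃ n, 2 ≤ n ∧ y ∈ homog K I n) ∧ y ∈ derivNull Q} := by
  apply le_antisymm
  · intro y hy
    rw [mem_derivNullIdeal] at hy
    have htop : y ∈ ⨆ n, homog K I n := by rw [iSup_homog]; trivial
    rw [Submodule.mem_iSup_iff_exists_finsupp] at htop
    obtain ⟨f, hf, hsum⟩ := htop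
    have hcomp : ∀ n, f n ∈ derivNull Q := by
      intro n
      refine mem_derivNull.2 fun w => ?_
      by_cases h : w.length = n
      · have h1 := mem_derivNull.1 hy w
        rw [← hsum, Finsupp.sum, map_sum] at h1
        rw [Finset.sum_eq_single n] at h1
        · exact h1
        · exact fun k _ hk => wordFunctional_of_mem_homog Q w (hf k) (by rw [h]; exact hk.symm)
        · intro hn; simp [Finsupp.notMem_support_iff.1 hn]
      · exact wordFunctional_of_mem_homog Q w (hf n) h
    rw [← hsum, Finsupp.sum]
    refine sum_mem fun n _ => ?_
    rcases n with _ | _ | n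
    · have h0 := hf 0
      rw [homog_zero, Submodule.mem_one] at h0
      obtain ⟨c, hc⟩ := h0
      have := counit_of_mem_derivNull (hcomp 0)
      rw [← hc] at this ⊢
      simp at this
      simp [this, zero_mem]
    · rw [eq_zero_of_mem_homog_one (hf 1) (hcomp 1)]
      exact zero_mem _
    · exact TwoSidedIdeal.subset_span ⟨⟨_, by omega, hf _⟩, hcomp _⟩
  · rw [TwoSidedIdeal.span_le]
    exact fun y hy => mem_derivNullIdeal.2 hy.2

theorem isNicholsRelationIdeal_derivNullIdeal : IsNicholsRelationIdeal Q (derivNullIdeal Q) :=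
  ⟨⟨_, fun _ hx => hx.1, derivNullIdeal_eq_span⟩, isCoideal_derivNullIdeal⟩

/-- By the Leibniz rule, elements without constant and linear terms form a two-sided ideal, and it
contains the generators. -/
theorem counit_eq_zero_and_counit_rightDeriv_eq_zero {S : Set (TV K I)}
    (hS : ∀ x ∈ S, ∃ n : ℕ, 2 ≤ n ∧ x ∈ homog K I n) {y : TV K I}
    (hy : y ∈ TwoSidedIdeal.span S) :
    counit K I y = 0 ∧ ∀ i, counit K I (rightDeriv Q i y) = 0 := by
  let L : TwoSidedIdeal (TV K I) := TwoSidedIdeal.mk'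
    {y | counit K I y = 0 ∧ ∀ i, counit K I (rightDeriv Q i y) = 0}
    (by simp) (fun hx hy => by simp_all) (fun hx => by simp_all)
    (fun hx => by simp_all [rightDeriv_mul]) (fun hx => by simp_all [rightDeriv_mul])
  have hle : TwoSidedIdeal.span S ≤ L := by
    rw [TwoSidedIdeal.span_le]
    intro x hx
    obtain ⟨n, hn, hxn⟩ := hS x hx
    obtain ⟨n, rfl⟩ := Nat.exists_eq_add_of_le' hn
    refine (TwoSidedIdeal.mem_mk' _ _ _ _ _ _ _).2 ⟨counit_of_mem_homog_succ hxn, fun i => ?_⟩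
    exact counit_of_mem_homog_succ (rightDeriv_mem_homog Q hxn i)
  have hL := hle hy
  rwa [TwoSidedIdeal.mem_mk'] at hL

theorem IsNicholsRelationIdeal.le_derivNullIdeal {J : TwoSidedIdeal (TV K I)}
    (hJ : IsNicholsRelationIdeal Q J) : J ≤ derivNullIdeal Q := by
  obtain ⟨⟨S, hS, rfl⟩, hco⟩ := hJ
  intro y hy
  rw [mem_derivNullIdeal]
  refine le_derivNull (S := idealSubspace (TwoSidedIdeal.span S)) ?_ ?_ (mem_idealSubspace.2 hy)
  · exact fun z hz =>
      (counit_eq_zero_and_counit_rightDeriv_eq_zero (Q := Q) hS (mem_idealSubspace.1 hz)).1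
  · intro i z hz
    have h1 := hco ⟨z, hz, rfl⟩
    have h2 := rid_lTensor_wordFunctional_comul Q [i] z
    change _ = rightDeriv Q i z at h2
    rw [← h2]
    -- The derivation is the comultiplication followed by a functional on the second factor. That
    -- functional sends J ⊗ T into J and kills T ⊗ J, so J is stable under derivations.
    have h3 : ∀ t ∈ LinearMap.range (TensorProduct.map (idealSubspace (TwoSidedIdeal.span S)).subtype
        (LinearMap.id : TV K I →ₗ[K] TV K I)) ⊔
      LinearMap.range (TensorProduct.map (LinearMap.id : TV K I →ₗ[K] TV K I)
        (idealSubspace (TwoSidedIdeal.span S)).subtype),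
      TensorProduct.rid K (TV K I) ((wordFunctional Q [i]).lTensor (TV K I) t) ∈
        idealSubspace (TwoSidedIdeal.span S) := by
      intro t ht
      obtain ⟨_, ⟨a, rfl⟩, _, ⟨b, rfl⟩, rfl⟩ := Submodule.mem_sup.1 ht
      rw [map_add, map_add]
      refine Submodule.add_mem _ ?_ ?_
      · induction a using TensorProduct.induction_on with
        | zero => simp
        | add x y hx hy =>
          simp only [map_add]
          exact Submodule.add_mem _ (hx (Submodule.add_mem _
            (Submodule.mem_sup_left ⟨x, rfl⟩) (Submodule.mem_sup_right ⟨b, rfl⟩)))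
            (hy (Submodule.add_mem _
            (Submodule.mem_sup_left ⟨y, rfl⟩) (Submodule.mem_sup_right ⟨b, rfl⟩)))
        | tmul x y =>
          simp only [TensorProduct.map_tmul, LinearMap.lTensor_tmul, TensorProduct.rid_tmul]
          exact Submodule.smul_mem _ _ x.2
      · clear ht
        induction b using TensorProduct.induction_on with
        | zero => simp
        | add x y hx hy => simp only [map_add]; exact Submodule.add_mem _ hx hy
        | tmul x y =>
          simp only [TensorProduct.map_tmul, LinearMap.lTensor_tmul, TensorProduct.rid_tmul]
          have : wordFunctional Q [i] ((idealSubspace (TwoSidedIdeal.span S)).subtype y) = 0 :=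
            (counit_eq_zero_and_counit_rightDeriv_eq_zero (Q := Q) hS
              (mem_idealSubspace.1 y.2)).2 i
          rw [this, zero_smul]
          exact Submodule.zero_mem _
    exact h3 _ h1

theorem nicholsIdeal_eq_derivNullIdeal : nicholsIdeal Q = derivNullIdeal Q :=
  le_antisymm (sSup_le fun _ hJ => IsNicholsRelationIdeal.le_derivNullIdeal hJ)
    (le_sSup isNicholsRelationIdeal_derivNullIdeal)

theorem ker_nicholsProj : LinearMap.ker (nicholsProj Q).toLinearMap = derivNull Q := by
  ext y
  rw [← mem_derivNullIdeal, ← nicholsIdeal_eq_derivNullIdeal, LinearMap.mem_ker,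
    TwoSidedIdeal.mem_iff]
  change ((y : (nicholsIdeal Q).ringCon.Quotient) = ((0 : TV K I) :)) ↔ _
  exact RingCon.eq _

end Grading

/-! ### Quantum integers and normalization factors -/

section QuantumScalars

variable {R : Type*} [CommRing R]

/-- The quantum integer over an arbitrary commutative ring. -/
def quantumInt (q : R) (m : ℕ) : R := ∑ i ∈ Finset.range m, q ^ i

@[simp] theorem quantumInt_zero (q : R) : quantumInt q 0 = 0 := by simp [quantumInt]

@[simp] theorem quantumInt_one (q : R) : quantumInt q 1 = 1 := by simp [quantumInt]

theorem quantumInt_succ (q : R) (m : ℕ) : quantumInt q (m + 1) = quantumInt q m + q ^ m := by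
  simp [quantumInt, Finset.sum_range_succ]

theorem quantumInt_succ' (q : R) (m : ℕ) : quantumInt q (m + 1) = q * quantumInt q m + 1 := by
  simp [quantumInt, Finset.sum_range_succ', Finset.mul_sum, pow_succ']

/-- The scalar `(k)_q (1 - q^{k-1} r)`. -/
def stepCoef (q r : R) (k : ℕ) : R := quantumInt q k * (1 - q ^ (k - 1) * r)

@[simp] theorem stepCoef_zero (q r : R) : stepCoef q r 0 = 0 := by simp [stepCoef]

/-- This recurrence is the scalar source of the commutation relation between lowering and raising.
-/
theorem stepCoef_succ (q r : R) (k : ℕ) :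
    stepCoef q r (k + 1) = q * stepCoef q r k + (1 - q ^ (2 * k) * r) := by
  cases k with
  | zero => simp [stepCoef]
  | succ k =>
    have h1 := quantumInt_succ q (k + 1)
    have h2 := quantumInt_succ' q (k + 1)
    simp only [stepCoef, Nat.add_sub_cancel]
    linear_combination h2 - q ^ (k + 1) * r * h1

theorem triangle_succ (i : ℕ) : (i + 1) * (i + 1 - 1) / 2 = i + i * (i - 1) / 2 := by
  rw [Nat.triangle_succ, add_comm]

end QuantumScalars

section Field

variable {K : Type*} [Field K]

theorem qInt_eq_quantumInt (q : K) (m : ℕ) : qInt q m = quantumInt q m := rfl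

/-- The normalization factor `(k)_q^! b_k`. -/
def normCoef (q r : K) (k : ℕ) : K := qFact q k * bCoef q r k

@[simp] theorem normCoef_zero (q r : K) : normCoef q r 0 = 1 := by
  simp [normCoef, qFact, bCoef]

theorem normCoef_succ (q r : K) (k : ℕ) :
    normCoef q r (k + 1) = normCoef q r k * stepCoef q r (k + 1) := by
  simp only [normCoef, qFact, bCoef, Finset.prod_range_succ, stepCoef, qInt_eq_quantumInt,
    Nat.add_sub_cancel]
  ring

theorem normCoef_ne_zero_of_le {q r : K} {k m : ℕ} (hm : normCoef q r m ≠ 0) (h : k ≤ m) :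
    normCoef q r k ≠ 0 := by
  induction m, h using Nat.le_induction with
  | base => exact hm
  | succ m _ ih => rw [normCoef_succ] at hm; exact ih (left_ne_zero_of_mul hm)

theorem stepCoef_ne_zero {q r : K} {k m : ℕ} (hm : normCoef q r m ≠ 0) (hk : k ≠ 0)
    (h : k ≤ m) : stepCoef q r k ≠ 0 := by
  obtain ⟨k, rfl⟩ := Nat.exists_eq_succ_of_ne_zero hk
  have := normCoef_ne_zero_of_le hm h
  rw [Nat.succ_eq_add_one, normCoef_succ] at this
  exact right_ne_zero_of_mul this

theorem quantumInt_ne_zero {q r : K} {k m : ℕ} (hm : normCoef q r m ≠ 0) (hk : k ≠ 0)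
    (h : k ≤ m) : quantumInt q k ≠ 0 :=
  left_ne_zero_of_mul (stepCoef_ne_zero hm hk h)

end Field

/-! ### Derivations of the elements `u k` -/

section RankTwoDerivations

variable {K : Type*} [Field K] (Q : Fin 2 → Fin 2 → Kˣ)

local notation "x₁" => (FreeAlgebra.ι K (0 : Fin 2) : TV K (Fin 2))

theorem twist_zero_u (k : ℕ) :
    twist Q 0 (u Q k) = (parQ Q ^ k * (Q 0 1 : K)) • u Q k := by
  induction k with
  | zero => simp [u]
  | succ k ih =>
    simp only [u, map_sub, map_mul, map_smul, ih, twist_ι, smul_sub, smul_mul_assoc,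
      mul_smul_comm, smul_smul]
    congr 1 <;> congr 1 <;> simp only [parQ] <;> ring

theorem twistOp_zero_u (k : ℕ) :
    twistOp Q 0 (u Q k) = (parQ Q ^ k * (Q 1 0 : K)) • u Q k := by
  induction k with
  | zero => simp [u]
  | succ k ih =>
    simp only [u, map_sub, map_mul, map_smul, ih, twistOp_ι, smul_sub, smul_mul_assoc,
      mul_smul_comm, smul_smul]
    congr 1 <;> congr 1 <;> simp only [parQ] <;> ring

theorem twist_one_u (k : ℕ) :
    twist Q 1 (u Q k) = ((Q 1 0 : K) ^ k * parS Q) • u Q k := by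
  induction k with
  | zero => simp [u, parS]
  | succ k ih =>
    simp only [u, map_sub, map_mul, map_smul, ih, twist_ι, smul_sub, smul_mul_assoc,
      mul_smul_comm, smul_smul]
    congr 1 <;> congr 1 <;> ring

theorem rightDeriv_zero_u (k : ℕ) : rightDeriv Q 0 (u Q k) = 0 := by
  induction k with
  | zero => simp [u]
  | succ k ih => simp [u, rightDeriv_mul, ih, twist_zero_u]

theorem rightDeriv_one_u (k : ℕ) :
    rightDeriv Q 1 (u Q k) = bCoef (parQ Q) (parR Q) k • x₁ ^ k := by
  induction k with
  | zero => simp [u, bCoef]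
  | succ k ih =>
    simp only [u, map_sub, map_smul, rightDeriv_mul, ih, rightDeriv_ι, twist_ι]
    simp only [one_ne_zero, if_false, mul_zero, zero_mul, add_zero, zero_add, smul_mul_assoc,
      mul_smul_comm, smul_smul, ← pow_succ, ← pow_succ', ← sub_smul]
    rw [bCoef, bCoef, Finset.prod_range_succ]
    congr 1
    simp only [parR]
    ring

theorem leftDeriv_zero_u_zero : leftDeriv Q 0 (u Q 0) = 0 := by simp [u]

/-- The scalar is the ratio of consecutive normalization factors, so on the normalized elements the
lowering operator becomes a plain index shift. -/
theorem leftDeriv_zero_u_succ (k : ℕ) :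
    leftDeriv Q 0 (u Q (k + 1)) = stepCoef (parQ Q) (parR Q) (k + 1) • u Q k := by
  induction k with
  | zero =>
    simp only [u, map_sub, map_smul, leftDeriv_mul, leftDeriv_ι, twistOp_ι]
    simp [stepCoef, sub_smul, parR, smul_smul]
  | succ k ih =>
    rw [u, map_sub, map_smul, leftDeriv_mul, leftDeriv_mul, ih, twistOp_ι, leftDeriv_ι, if_pos rfl,
      twistOp_zero_u, stepCoef_succ _ _ (k + 1)]
    rw [show (1 : TV K (Fin 2)) * u Q (k + 1) = u Q (k + 1) from one_mul _, mul_one]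
    simp only [smul_mul_assoc, mul_smul_comm, smul_smul, smul_add, add_smul]
    rw [show u Q (k + 1) = x₁ * u Q k - (parQ Q ^ k * (Q 0 1 : K)) • (u Q k * x₁) from rfl]
    simp only [smul_sub, smul_smul, sub_smul, one_smul]
    simp only [parR, parQ]
    module

theorem leftDeriv_one_u_succ (k : ℕ) : leftDeriv Q 1 (u Q (k + 1)) = 0 := by
  induction k with
  | zero => simp [u, leftDeriv_mul]
  | succ k ih =>
    rw [u, map_sub, map_smul, leftDeriv_mul, leftDeriv_mul, ih]
    simp

theorem leftDeriv_one_u_zero : leftDeriv Q 1 (u Q 0) = 1 := by simp [u]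

theorem rightDeriv_zero_pow (k : ℕ) :
    rightDeriv Q 0 (x₁ ^ k) = quantumInt (parQ Q) k • x₁ ^ (k - 1) := by
  induction k with
  | zero => simp
  | succ k ih =>
    rw [pow_succ, rightDeriv_mul, ih, quantumInt_succ']
    cases k with
    | zero => simp
    | succ k =>
      simp only [rightDeriv_ι, if_true, mul_one, twist_ι, smul_mul_assoc, mul_smul_comm,
        Nat.add_sub_cancel, ← pow_succ, smul_smul, add_smul, one_smul]
      rw [add_comm]
      rfl

theorem leftDeriv_one_pow (k : ℕ) : leftDeriv Q 1 (x₁ ^ k) = 0 := by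
  induction k with
  | zero => simp
  | succ k ih => simp [pow_succ, leftDeriv_mul, ih]

theorem twistOp_one_pow (k : ℕ) : twistOp Q 1 (x₁ ^ k) = (Q 0 1 : K) ^ k • x₁ ^ k := by
  rw [map_pow, twistOp_ι, smul_pow]

theorem pow_notMem_derivNull {k : ℕ} (hk : normCoef (parQ Q) (parR Q) k ≠ 0) :
    x₁ ^ k ∉ derivNull Q := by
  induction k with
  | zero => intro h; simpa using counit_of_mem_derivNull h
  | succ k ih =>
    intro h
    refine ih (normCoef_ne_zero_of_le hk k.le_succ) ?_
    have h1 := rightDeriv_mem_derivNull h 0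
    rw [rightDeriv_zero_pow] at h1
    exact (Submodule.smul_mem_iff _ (quantumInt_ne_zero hk k.succ_ne_zero le_rfl)).1 h1

/-- The convention that the inverse of 0 is 0 absorbs the case distinction. -/
theorem uHat_eq (k : ℕ) : uHat Q k = (normCoef (parQ Q) (parR Q) k)⁻¹ • u Q k := by
  rw [uHat]
  split_ifs with h
  · rfl
  · have : normCoef (parQ Q) (parR Q) k = 0 := not_not.1 h
    rw [this, inv_zero, zero_smul]

theorem uHat_zero : uHat Q 0 = u Q 0 := by simp [uHat_eq]

theorem leftDeriv_zero_uHat_zero : leftDeriv Q 0 (uHat Q 0) = 0 := by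
  rw [uHat_zero, leftDeriv_zero_u_zero]

theorem leftDeriv_zero_uHat_succ {k : ℕ} (hk : normCoef (parQ Q) (parR Q) (k + 1) ≠ 0) :
    leftDeriv Q 0 (uHat Q (k + 1)) = uHat Q k := by
  rw [uHat_eq, uHat_eq, map_smul, leftDeriv_zero_u_succ, smul_smul]
  congr 1
  rw [normCoef_succ] at hk ⊢
  have h1 := left_ne_zero_of_mul hk
  have h2 := right_ne_zero_of_mul hk
  field_simp

theorem twistOp_zero_uHat (k : ℕ) :
    twistOp Q 0 (uHat Q k) = (parQ Q ^ k * (Q 1 0 : K)) • uHat Q k := by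
  rw [uHat_eq, map_smul, twistOp_zero_u, smul_comm]

theorem twist_zero_uHat (k : ℕ) :
    twist Q 0 (uHat Q k) = (parQ Q ^ k * (Q 0 1 : K)) • uHat Q k := by
  rw [uHat_eq, map_smul, twist_zero_u, smul_comm]

theorem twist_one_uHat (k : ℕ) :
    twist Q 1 (uHat Q k) = ((Q 1 0 : K) ^ k * parS Q) • uHat Q k := by
  rw [uHat_eq, map_smul, twist_one_u, smul_comm]

theorem rightDeriv_one_uHat {k : ℕ} (hk : normCoef (parQ Q) (parR Q) k ≠ 0) :
    rightDeriv Q 1 (uHat Q k) = (qFact (parQ Q) k)⁻¹ • x₁ ^ k := by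
  rw [uHat_eq, map_smul, rightDeriv_one_u, smul_smul]
  congr 1
  rw [normCoef] at hk ⊢
  have h1 := left_ne_zero_of_mul hk
  have h2 := right_ne_zero_of_mul hk
  field_simp

theorem leftDeriv_one_uHat_succ (k : ℕ) : leftDeriv Q 1 (uHat Q (k + 1)) = 0 := by
  rw [uHat_eq, map_smul, leftDeriv_one_u_succ, smul_zero]

theorem leftDeriv_one_uHat_zero : leftDeriv Q 1 (uHat Q 0) = 1 := by
  rw [uHat_zero, leftDeriv_one_u_zero]

theorem ι_zero_mul_uHat {k : ℕ} (hk : normCoef (parQ Q) (parR Q) (k + 1) ≠ 0) :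
    x₁ * uHat Q k = stepCoef (parQ Q) (parR Q) (k + 1) • uHat Q (k + 1) +
      (parQ Q ^ k * (Q 0 1 : K)) • (uHat Q k * x₁) := by
  have h : stepCoef (parQ Q) (parR Q) (k + 1) • uHat Q (k + 1) =
      (normCoef (parQ Q) (parR Q) k)⁻¹ • u Q (k + 1) := by
    rw [uHat_eq, smul_smul]
    congr 1
    rw [normCoef_succ] at hk ⊢
    have h1 := left_ne_zero_of_mul hk
    have h2 := right_ne_zero_of_mul hk
    field_simp
  rw [h, uHat_eq, u]
  simp only [smul_sub, mul_smul_comm, smul_mul_assoc, smul_smul]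
  rw [mul_comm (parQ Q ^ k * (Q 0 1 : K))]
  abel

/-- The sl₂-type relation: the last term becomes the scalar 1 - q^(2m) r² on `U m`. -/
theorem leftDeriv_adj_zero (y : TV K (Fin 2)) :
    leftDeriv Q 0 (adj Q 0 y) =
      parQ Q • adj Q 0 (leftDeriv Q 0 y) + (y - twistOp Q 0 (twist Q 0 y)) := by
  have h : ∀ y, adj Q 0 y = x₁ * y - twist Q 0 y * x₁ := fun _ => rfl
  rw [h, h, map_sub, leftDeriv_mul, leftDeriv_mul, leftDeriv_twist]
  simp only [leftDeriv_ι, if_true, one_mul, mul_one, twistOp_ι, smul_sub, smul_mul_assoc, parQ]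
  abel

end RankTwoDerivations

/-! ### Lowering and raising in coordinates on `U m` -/

section Combinations

variable {K : Type*} [Field K] (Q : Fin 2 → Fin 2 → Kˣ)

local notation "x₁" => (FreeAlgebra.ι K (0 : Fin 2) : TV K (Fin 2))

/-- The linear combination `∑_{i ≤ m} c_i û_i û_{m-i}`. -/
def comb (m : ℕ) (c : ℕ → K) : TV K (Fin 2) :=
  ∑ i ∈ Finset.range (m + 1), c i • (uHat Q i * uHat Q (m - i))

/-- The action of `∂'_1` on coordinates. -/
def lowerCoord (c : ℕ → K) (i : ℕ) : K := c (i + 1) + parQ Q ^ i * (Q 1 0 : K) * c i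

/-- The action of `ad x_1` on coordinates, with values in degree `m`. -/
def raiseCoord (m : ℕ) (c : ℕ → K) (i : ℕ) : K :=
  stepCoef (parQ Q) (parR Q) i * c (i - 1) +
    parQ Q ^ i * (Q 0 1 : K) * stepCoef (parQ Q) (parR Q) (m - i) * c i

/-- The coordinates of `P_k`, for all `k` at once. -/
def lowestCoord (i : ℕ) : K := (-(Q 1 0 : K)) ^ i * parQ Q ^ (i * (i - 1) / 2)

theorem comb_lowestCoord (m : ℕ) : comb Q m (lowestCoord Q) = P Q m := rfl

variable {Q}

theorem comb_congr {m : ℕ} {c d : ℕ → K} (h : ∀ i ≤ m, c i = d i) : comb Q m c = comb Q m d :=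
  Finset.sum_congr rfl fun i hi => by rw [h i (Nat.lt_succ_iff.1 (Finset.mem_range.1 hi))]

theorem comb_smul (m : ℕ) (a : K) (c : ℕ → K) :
    comb Q m (fun i => a * c i) = a • comb Q m c := by
  simp [comb, Finset.smul_sum, smul_smul]

theorem comb_sub (m : ℕ) (c d : ℕ → K) :
    comb Q m (fun i => c i - d i) = comb Q m c - comb Q m d := by
  simp [comb, sub_smul]

theorem lowerCoord_lowestCoord (i : ℕ) : lowerCoord Q (lowestCoord Q) i = 0 := by
  simp only [lowerCoord, lowestCoord, triangle_succ]
  ring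

theorem leftDeriv_zero_comb_zero (c : ℕ → K) : leftDeriv Q 0 (comb Q 0 c) = 0 := by
  simp [comb, leftDeriv_mul, leftDeriv_zero_uHat_zero]

theorem leftDeriv_zero_comb {m : ℕ} (hm : normCoef (parQ Q) (parR Q) (m + 1) ≠ 0) (c : ℕ → K) :
    leftDeriv Q 0 (comb Q (m + 1) c) = comb Q m (lowerCoord Q c) := by
  have h1 : ∑ i ∈ Finset.range (m + 2),
      c i • (leftDeriv Q 0 (uHat Q i) * uHat Q (m + 1 - i)) =
      ∑ i ∈ Finset.range (m + 1), c (i + 1) • (uHat Q i * uHat Q (m - i)) := by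
    rw [Finset.sum_range_succ', leftDeriv_zero_uHat_zero, zero_mul, smul_zero, add_zero]
    refine Finset.sum_congr rfl fun i hi => ?_
    rw [leftDeriv_zero_uHat_succ Q (normCoef_ne_zero_of_le hm (Finset.mem_range.1 hi)),
      Nat.add_sub_add_right]
  have h2 : ∑ i ∈ Finset.range (m + 2),
      c i • (twistOp Q 0 (uHat Q i) * leftDeriv Q 0 (uHat Q (m + 1 - i))) =
      ∑ i ∈ Finset.range (m + 1),
        (parQ Q ^ i * (Q 1 0 : K) * c i) • (uHat Q i * uHat Q (m - i)) := by
    rw [Finset.sum_range_succ, Nat.sub_self, leftDeriv_zero_uHat_zero, mul_zero, smul_zero,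
      add_zero]
    refine Finset.sum_congr rfl fun i hi => ?_
    have hi := Nat.lt_succ_iff.1 (Finset.mem_range.1 hi)
    rw [Nat.succ_sub hi, leftDeriv_zero_uHat_succ Q (normCoef_ne_zero_of_le hm (by omega)),
      twistOp_zero_uHat, smul_mul_assoc, smul_smul, mul_comm (c i)]
  simp only [comb, map_sum, map_smul, leftDeriv_mul, smul_add, Finset.sum_add_distrib]
  rw [h1, h2, ← Finset.sum_add_distrib]
  simp only [lowerCoord, add_smul]

theorem adj_zero_uHat_mul_uHat {i j : ℕ} (hi : normCoef (parQ Q) (parR Q) (i + 1) ≠ 0)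
    (hj : normCoef (parQ Q) (parR Q) (j + 1) ≠ 0) :
    adj Q 0 (uHat Q i * uHat Q j) =
      stepCoef (parQ Q) (parR Q) (i + 1) • (uHat Q (i + 1) * uHat Q j) +
      (parQ Q ^ i * (Q 0 1 : K) * stepCoef (parQ Q) (parR Q) (j + 1)) •
        (uHat Q i * uHat Q (j + 1)) := by
  have h : ∀ y, adj Q 0 y = x₁ * y - twist Q 0 y * x₁ := fun _ => rfl
  rw [h, ← mul_assoc, ι_zero_mul_uHat Q hi, map_mul, twist_zero_uHat, twist_zero_uHat, add_mul]
  simp only [smul_mul_assoc, mul_assoc, ι_zero_mul_uHat Q hj, mul_add, mul_smul_comm, smul_add,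
    smul_smul]
  module

/-- The truncated index `i - 1` at i = 0 and the unused coordinate `c (m + 1)` do no harm: both are
multiplied by `stepCoef` at 0, which vanishes. -/
theorem adj_zero_comb {m : ℕ} (hm : normCoef (parQ Q) (parR Q) (m + 1) ≠ 0) (c : ℕ → K) :
    adj Q 0 (comb Q m c) = comb Q (m + 1) (raiseCoord Q (m + 1) c) := by
  have h : adj Q 0 (comb Q m c) =
      ∑ i ∈ Finset.range (m + 1), (stepCoef (parQ Q) (parR Q) (i + 1) * c i) •
        (uHat Q (i + 1) * uHat Q (m - i)) +
      ∑ i ∈ Finset.range (m + 1),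
        (parQ Q ^ i * (Q 0 1 : K) * stepCoef (parQ Q) (parR Q) (m + 1 - i) * c i) •
        (uHat Q i * uHat Q (m + 1 - i)) := by
    rw [comb, map_sum, ← Finset.sum_add_distrib]
    refine Finset.sum_congr rfl fun i hi => ?_
    have hi := Nat.lt_succ_iff.1 (Finset.mem_range.1 hi)
    rw [map_smul, adj_zero_uHat_mul_uHat (normCoef_ne_zero_of_le hm (by omega))
      (normCoef_ne_zero_of_le hm (by omega)), Nat.succ_sub hi]
    simp only [Nat.succ_eq_add_one]
    module
  rw [h, comb]
  simp only [raiseCoord, add_smul, Finset.sum_add_distrib]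
  congr 1
  · conv_rhs => rw [Finset.sum_range_succ']
    simp
  · conv_rhs => rw [Finset.sum_range_succ]
    simp

theorem comb_mem_U (m : ℕ) (c : ℕ → K) : comb Q m c ∈ U Q m := by
  refine Submodule.sum_mem _ fun i hi => Submodule.smul_mem _ _ ?_
  rw [uHat_eq, uHat_eq, smul_mul_assoc, mul_smul_comm]
  exact Submodule.smul_mem _ _ (Submodule.smul_mem _ _ (Submodule.subset_span
    ⟨i, Nat.lt_succ_iff.1 (Finset.mem_range.1 hi), rfl⟩))

theorem exists_comb_of_mem_U {m : ℕ} (hm : normCoef (parQ Q) (parR Q) m ≠ 0)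
    {y : TV K (Fin 2)} (hy : y ∈ U Q m) : ∃ c, y = comb Q m c := by
  induction hy using Submodule.span_induction with
  | mem y h =>
    obtain ⟨i, hi, rfl⟩ := h
    refine ⟨fun j => if j = i then normCoef (parQ Q) (parR Q) i *
      normCoef (parQ Q) (parR Q) (m - i) else 0, ?_⟩
    rw [comb, Finset.sum_eq_single i]
    · have h1 := normCoef_ne_zero_of_le hm hi
      have h2 := normCoef_ne_zero_of_le hm (Nat.sub_le m i)
      rw [if_pos rfl, uHat_eq, uHat_eq, smul_mul_assoc, mul_smul_comm, smul_smul, smul_smul]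
      field_simp
      simp
    · intro j _ hj; rw [if_neg hj, zero_smul]
    · intro h; exact absurd (Finset.mem_range.2 (Nat.lt_succ_of_le hi)) h
  | zero => exact ⟨0, by simp [comb]⟩
  | add x y _ _ hx hy =>
    obtain ⟨c, rfl⟩ := hx
    obtain ⟨d, rfl⟩ := hy
    exact ⟨c + d, by simp [comb, add_smul, Finset.sum_add_distrib]⟩
  | smul a x _ hx =>
    obtain ⟨c, rfl⟩ := hx
    exact ⟨_, (comb_smul m a c).symm⟩

theorem adj_mem_U {m : ℕ} {y : TV K (Fin 2)} (hy : y ∈ U Q m) : adj Q 0 y ∈ U Q (m + 1) := by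
  have h : ∀ y, adj Q 0 y = x₁ * y - twist Q 0 y * x₁ := fun _ => rfl
  induction hy using Submodule.span_induction with
  | mem y hy =>
    obtain ⟨i, hi, rfl⟩ := hy
    have : adj Q 0 (u Q i * u Q (m - i)) = u Q (i + 1) * u Q (m + 1 - (i + 1)) +
        (parQ Q ^ i * (Q 0 1 : K)) • (u Q i * u Q (m + 1 - i)) := by
      rw [Nat.succ_sub hi, Nat.add_sub_add_right, h, map_mul, twist_zero_u, twist_zero_u, u, u]
      simp only [sub_mul, mul_sub, smul_mul_assoc, mul_smul_comm, smul_sub, smul_smul, mul_assoc]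
      module
    rw [this]
    exact Submodule.add_mem _ (Submodule.subset_span ⟨i + 1, by omega, rfl⟩)
      (Submodule.smul_mem _ _ (Submodule.subset_span ⟨i, by omega, rfl⟩))
  | zero => simp
  | add x y _ _ hx hy => rw [map_add]; exact Submodule.add_mem _ hx hy
  | smul a x _ hx => rw [map_smul]; exact Submodule.smul_mem _ _ hx

theorem leftDeriv_mem_U {m : ℕ} {y : TV K (Fin 2)} (hy : y ∈ U Q (m + 1)) :
    leftDeriv Q 0 y ∈ U Q m := by
  induction hy using Submodule.span_induction with
  | mem y hy =>
    obtain ⟨i, hi, rfl⟩ := hy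
    rw [leftDeriv_mul, twistOp_zero_u]
    refine Submodule.add_mem _ ?_ ?_
    · rcases i with _ | i
      · rw [leftDeriv_zero_u_zero, zero_mul]; exact Submodule.zero_mem _
      · rw [leftDeriv_zero_u_succ, smul_mul_assoc, Nat.add_sub_add_right]
        exact Submodule.smul_mem _ _ (Submodule.subset_span ⟨i, by omega, rfl⟩)
    · rcases hi.eq_or_lt with rfl | hi
      · rw [Nat.sub_self, leftDeriv_zero_u_zero, mul_zero]; exact Submodule.zero_mem _
      · rw [Nat.succ_sub (Nat.lt_succ_iff.1 hi), leftDeriv_zero_u_succ, smul_mul_assoc,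
          mul_smul_comm]
        exact Submodule.smul_mem _ _ (Submodule.smul_mem _ _ (Submodule.subset_span
          ⟨i, by omega, rfl⟩))
  | zero => simp
  | add x y _ _ hx hy => rw [map_add]; exact Submodule.add_mem _ hx hy
  | smul a x _ hx => rw [map_smul]; exact Submodule.smul_mem _ _ hx

theorem twistOp_twist_of_mem_U {m : ℕ} {y : TV K (Fin 2)} (hy : y ∈ U Q m) :
    twistOp Q 0 (twist Q 0 y) = (parQ Q ^ (2 * m) * parR Q ^ 2) • y := by
  induction hy using Submodule.span_induction with
  | mem y hy =>
    obtain ⟨i, hi, rfl⟩ := hy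
    obtain ⟨j, rfl⟩ := Nat.exists_eq_add_of_le hi
    rw [Nat.add_sub_cancel_left]
    simp only [map_mul, twist_zero_u, map_smul, twistOp_zero_u, smul_mul_assoc, mul_smul_comm,
      smul_smul]
    congr 1
    simp only [parR]
    ring
  | zero => simp
  | add x y _ _ hx hy => rw [map_add, map_add, hx, hy, smul_add]
  | smul a x _ hx => rw [map_smul, map_smul, hx, smul_comm]

theorem counit_of_mem_U {m : ℕ} {y : TV K (Fin 2)} (hy : y ∈ U Q m) :
    counit K (Fin 2) y = 0 := by
  have h : ∀ k, counit K (Fin 2) (u Q k) = 0 := by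
    intro k; cases k <;> simp [u]
  induction hy using Submodule.span_induction with
  | mem y hy => obtain ⟨i, hi, rfl⟩ := hy; simp [h]
  | zero => simp
  | add x y _ _ hx hy => simp [hx, hy]
  | smul a x _ hx => simp [hx]

theorem rightDeriv_zero_of_mem_U {m : ℕ} {y : TV K (Fin 2)} (hy : y ∈ U Q m) :
    rightDeriv Q 0 y = 0 := by
  induction hy using Submodule.span_induction with
  | mem y hy => obtain ⟨i, hi, rfl⟩ := hy; simp [rightDeriv_mul, rightDeriv_zero_u]
  | zero => simp
  | add x y _ _ hx hy => simp [hx, hy]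
  | smul a x _ hx => simp [hx]

/-- `leftDeriv Q 1` kills every `uHat` except the one of index 0, so only the two extreme products
contribute. -/
theorem leftDeriv_one_rightDeriv_one_comb {m : ℕ} (hm : normCoef (parQ Q) (parR Q) m ≠ 0)
    (c : ℕ → K) : leftDeriv Q 1 (rightDeriv Q 1 (comb Q m c)) =
      ((c 0 + parS Q * (Q 0 1 : K) ^ m * c m) * (qFact (parQ Q) m)⁻¹) • x₁ ^ m := by
  have hterm : ∀ i ∈ Finset.range (m + 1),
      leftDeriv Q 1 (rightDeriv Q 1 (c i • (uHat Q i * uHat Q (m - i)))) =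
      (if i = 0 then (c 0 * (qFact (parQ Q) m)⁻¹) • x₁ ^ m else 0) +
      (if i = m then (parS Q * (Q 0 1 : K) ^ m * c m * (qFact (parQ Q) m)⁻¹) • x₁ ^ m
        else 0) := by
    intro i hi
    have hi := Nat.lt_succ_iff.1 (Finset.mem_range.1 hi)
    rw [map_smul, map_smul, rightDeriv_mul,
      rightDeriv_one_uHat Q (normCoef_ne_zero_of_le hm hi),
      rightDeriv_one_uHat Q (normCoef_ne_zero_of_le hm (Nat.sub_le m i)), twist_one_uHat, map_add,
      leftDeriv_mul, leftDeriv_mul, map_smul, map_smul, map_smul, map_smul, leftDeriv_one_pow,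
      leftDeriv_one_pow, twistOp_one_pow, smul_add]
    simp only [smul_zero, mul_zero, add_zero, zero_mul, zero_add]
    congr 1
    · rcases i with _ | i
      · simp [leftDeriv_one_uHat_zero, smul_smul]
      · simp [leftDeriv_one_uHat_succ]
    · rcases hi.eq_or_lt with rfl | hlt
      · rw [if_pos rfl, Nat.sub_self, leftDeriv_one_uHat_zero]
        simp only [pow_zero, one_mul, smul_smul, mul_smul_comm, mul_one]
        congr 1
        ring
      · obtain ⟨j, hj⟩ := Nat.exists_eq_add_of_lt hlt
        rw [if_neg hlt.ne, show m - i = j + 1 by omega, leftDeriv_one_uHat_succ]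
        simp
  rw [comb, map_sum, map_sum, Finset.sum_congr rfl hterm, Finset.sum_add_distrib,
    Finset.sum_ite_eq', Finset.sum_ite_eq', if_pos (by simp), if_pos (by simp), ← add_smul,
    ← add_mul]

/-- Elements of `U m` are killed by `rightDeriv Q 0`, so only `rightDeriv Q 1` matters, and its
value is tested by left derivations. The one by x₁ commutes past it. The one by x₂ leaves a scalar
multiple of x₁^m, which is not in `derivNull`, so the scalar must vanish. -/
theorem comb_mem_derivNull_iff {m : ℕ} (hm : normCoef (parQ Q) (parR Q) m ≠ 0) (c : ℕ → K) :
    comb Q m c ∈ derivNull Q ↔ leftDeriv Q 0 (comb Q m c) ∈ derivNull Q ∧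
      c 0 + parS Q * (Q 0 1 : K) ^ m * c m = 0 := by
  have hq : qFact (parQ Q) m ≠ 0 := left_ne_zero_of_mul hm
  have hpow := pow_notMem_derivNull Q hm
  constructor
  · intro h
    refine ⟨(mem_derivNull_iff_left.1 h).2 0, ?_⟩
    have h1 := (mem_derivNull_iff_left.1 (rightDeriv_mem_derivNull h 1)).2 1
    rw [leftDeriv_one_rightDeriv_one_comb hm] at h1
    by_contra h0
    exact hpow ((Submodule.smul_mem_iff _ (mul_ne_zero h0 (inv_ne_zero hq))).1 h1)
  · rintro ⟨h1, h2⟩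
    have hU := comb_mem_U (Q := Q) m c
    refine mem_derivNull_iff.2 ⟨counit_of_mem_U hU, fun i => ?_⟩
    fin_cases i
    · simp only [Fin.zero_eta, rightDeriv_zero_of_mem_U hU]
      exact Submodule.zero_mem _
    · simp only [Fin.mk_one]
      refine mem_derivNull_iff_left.2 ⟨?_, fun i => ?_⟩
      · rw [← counit_leftDeriv]
        have : ∀ y ∈ U Q m, counit K (Fin 2) (leftDeriv Q 1 y) = 0 := by
          have h : ∀ k, counit K (Fin 2) (u Q k) = 0 := by
            intro k; cases k <;> simp [u]
          have h' : ∀ k, counit K (Fin 2) (twistOp Q 1 (u Q k)) = 0 := by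
            intro k; cases k <;> simp [u]
          intro y hy
          induction hy using Submodule.span_induction with
          | mem y hy => obtain ⟨i, hi, rfl⟩ := hy; simp [leftDeriv_mul, h, h']
          | zero => simp
          | add x y _ _ hx hy => simp [hx, hy]
          | smul a x _ hx => simp [hx]
        exact this _ hU
      · fin_cases i
        · simp only [Fin.zero_eta]
          rw [leftDeriv_rightDeriv_comm]
          exact rightDeriv_mem_derivNull h1 1
        · simp only [Fin.mk_one]
          rw [leftDeriv_one_rightDeriv_one_comb hm, h2, zero_mul, zero_smul]
          exact Submodule.zero_mem _

end Combinations

/-! ### Independence of the products, and lowest weight vectors -/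

section LinearIndependence

variable {K : Type*} [Field K] (Q : Fin 2 → Fin 2 → Kˣ)

open Polynomial in
/-- A representation of `T(V)` which separates the products `u_i u_{m-i}`. -/
def separatingHom (K : Type*) [Field K] : TV K (Fin 2) →ₐ[K] Matrix (Fin 3) (Fin 3) K[X] :=
  FreeAlgebra.lift K ![!![X, 0, 0; 0, 1, 0; 0, 0, 0], !![0, 1, 0; 0, 0, 1; 0, 0, 0]]

open Polynomial in
/-- The polynomial `∏_{k < i} (X - q^k q₁₂)`. -/
def separatingPoly (i : ℕ) : K[X] :=
  ∏ k ∈ Finset.range i, (X - C (parQ Q ^ k * (Q 0 1 : K)))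

open Polynomial in
-- Each braided commutator with x₁ multiplies the first superdiagonal entry by X - q^k q₁₂ and
-- leaves the second equal to 1. So u_i u_{m-i} has a monic polynomial of degree i in its corner,
-- and these are independent.
theorem separatingHom_u (k : ℕ) :
    separatingHom K (u Q k) = !![0, separatingPoly Q k, 0; 0, 0, 1; 0, 0, 0] := by
  induction k with
  | zero => simp [u, separatingHom, separatingPoly]
  | succ k ih =>
    rw [u, map_sub, map_smul, map_mul, map_mul, ih]
    have h0 : separatingHom K (FreeAlgebra.ι K 0) = !![X, 0, 0; 0, 1, 0; 0, 0, 0] := by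
      simp [separatingHom]
    rw [h0, separatingPoly, separatingPoly, Finset.prod_range_succ]
    ext1 i j
    fin_cases i <;> fin_cases j <;> simp [smul_eq_C_mul]
    ring

open Polynomial in
theorem natDegree_separatingPoly (i : ℕ) :
    (separatingPoly Q i).natDegree = i := by
  rw [separatingPoly, natDegree_prod_of_monic _ _ (fun k _ => monic_X_sub_C _)]
  simp only [natDegree_X_sub_C, Finset.sum_const, Finset.card_range, smul_eq_mul, mul_one]

open Polynomial in
theorem monic_separatingPoly (i : ℕ) : (separatingPoly Q i).Monic :=
  monic_prod_of_monic _ _ fun _ _ => monic_X_sub_C _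

open Polynomial in
theorem linearIndependent_separatingPoly : LinearIndependent K (separatingPoly Q) := by
  let S : Polynomial.Sequence K :=
    { elems' := separatingPoly Q
      degree_eq' := fun i => by
        rw [degree_eq_natDegree (monic_separatingPoly Q i).ne_zero, natDegree_separatingPoly] }
  exact S.linearIndependent

variable {Q}

theorem eq_zero_of_comb_eq_zero {m : ℕ} (hm : normCoef (parQ Q) (parR Q) m ≠ 0) {c : ℕ → K}
    (h : comb Q m c = 0) : ∀ i ≤ m, c i = 0 := by
  have h1 : ∑ i ∈ Finset.range (m + 1), (c i * ((normCoef (parQ Q) (parR Q) i)⁻¹ *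
      (normCoef (parQ Q) (parR Q) (m - i))⁻¹)) • separatingPoly Q i = 0 := by
    have h2 := congr_arg (fun y => separatingHom K y 0 2) h
    simp only [comb, map_sum, Matrix.sum_apply, map_zero, Matrix.zero_apply] at h2
    rw [← h2]
    refine Finset.sum_congr rfl fun i _ => ?_
    rw [map_smul, map_mul, uHat_eq, uHat_eq, map_smul, map_smul, separatingHom_u,
      separatingHom_u]
    simp [smul_smul, mul_comm]
  intro i hi
  have h3 := linearIndependent_iff'.1 (linearIndependent_separatingPoly Q) _ _ h1 i
    (Finset.mem_range.2 (Nat.lt_succ_of_le hi))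
  refine (mul_eq_zero.1 h3).resolve_right (mul_ne_zero ?_ ?_)
  · exact inv_ne_zero (normCoef_ne_zero_of_le hm hi)
  · exact inv_ne_zero (normCoef_ne_zero_of_le hm (Nat.sub_le m i))

theorem comb_injective {m : ℕ} (hm : normCoef (parQ Q) (parR Q) m ≠ 0) {c d : ℕ → K}
    (h : comb Q m c = comb Q m d) : ∀ i ≤ m, c i = d i := by
  intro i hi
  have h1 : comb Q m (fun i => c i - d i) = 0 := by rw [comb_sub, h, sub_self]
  exact sub_eq_zero.1 (eq_zero_of_comb_eq_zero hm h1 i hi)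

/-- The raising operator is triangular in coordinates. Its diagonal entries at i ≤ m involve
`stepCoef` at m + 1 - i, which is nonzero by hypothesis. -/
theorem adj_zero_injOn_U {m : ℕ} (hm : normCoef (parQ Q) (parR Q) (m + 1) ≠ 0)
    {y : TV K (Fin 2)} (hy : y ∈ U Q m) (h : adj Q 0 y = 0) : y = 0 := by
  obtain ⟨c, rfl⟩ := exists_comb_of_mem_U (normCoef_ne_zero_of_le hm m.le_succ) hy
  rw [adj_zero_comb hm] at h
  have h1 := eq_zero_of_comb_eq_zero hm h
  have h2 : ∀ i ≤ m, c i = 0 := by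
    intro i
    induction i using Nat.strong_induction_on with
    | h i ih =>
      intro hi
      have h3 := h1 i (by omega)
      have h4 : stepCoef (parQ Q) (parR Q) i * c (i - 1) = 0 := by
        rcases i with _ | i
        · simp
        · rw [ih (i + 1 - 1) (by omega) (by omega), mul_zero]
      rw [raiseCoord, h4, zero_add] at h3
      refine (mul_eq_zero.1 h3).resolve_left (mul_ne_zero (mul_ne_zero ?_ (Units.ne_zero _)) ?_)
      · exact pow_ne_zero _ (Units.ne_zero _)
      · exact stepCoef_ne_zero hm (by omega) (by omega)
  rw [comb_congr (d := fun _ => 0) h2]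
  simp [comb]

theorem P_mem_U (m : ℕ) : P Q m ∈ U Q m := comb_mem_U m (lowestCoord Q)

theorem P_ne_zero {m : ℕ} (hm : normCoef (parQ Q) (parR Q) m ≠ 0) : P Q m ≠ 0 := by
  intro h
  have := eq_zero_of_comb_eq_zero hm (c := lowestCoord Q) h 0 (Nat.zero_le _)
  simp [lowestCoord] at this

theorem leftDeriv_zero_P {m : ℕ} (hm : normCoef (parQ Q) (parR Q) m ≠ 0) :
    leftDeriv Q 0 (P Q m) = 0 := by
  rw [← comb_lowestCoord]
  cases m with
  | zero => exact leftDeriv_zero_comb_zero _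
  | succ m =>
    rw [leftDeriv_zero_comb hm, comb_congr (d := fun _ => 0)
      (fun i _ => lowerCoord_lowestCoord i)]
    simp [comb]

/-- Being killed by the lowering operator is a first-order recursion on coordinates, hence
determined by `c 0`. -/
theorem comb_eq_smul_P {m : ℕ} (hm : normCoef (parQ Q) (parR Q) m ≠ 0) {c : ℕ → K}
    (h : leftDeriv Q 0 (comb Q m c) = 0) : comb Q m c = c 0 • P Q m := by
  rw [← comb_lowestCoord, ← comb_smul]
  apply comb_congr
  cases m with
  | zero =>
    intro i hi
    obtain rfl := Nat.le_zero.1 hi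
    simp [lowestCoord]
  | succ m =>
    rw [leftDeriv_zero_comb hm] at h
    have h1 := eq_zero_of_comb_eq_zero (normCoef_ne_zero_of_le hm m.le_succ) h
    intro i
    induction i with
    | zero => simp [lowestCoord]
    | succ i ih =>
      intro hi
      have h2 := h1 i (by omega)
      have h3 := lowerCoord_lowestCoord (Q := Q) i
      rw [lowerCoord] at h2 h3
      rw [ih (by omega)] at h2
      linear_combination h2 - c 0 * h3

theorem exists_eq_smul_P {m : ℕ} (hm : normCoef (parQ Q) (parR Q) m ≠ 0) {y : TV K (Fin 2)}
    (hy : y ∈ U Q m) (h : leftDeriv Q 0 y = 0) : ∃ a : K, y = a • P Q m := by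
  obtain ⟨c, rfl⟩ := exists_comb_of_mem_U hm hy
  exact ⟨_, comb_eq_smul_P hm h⟩

theorem P_mem_derivNull_iff {m : ℕ} (hm : normCoef (parQ Q) (parR Q) m ≠ 0) :
    P Q m ∈ derivNull Q ↔
      parQ Q ^ (m * (m - 1) / 2) * (-parR Q) ^ m * parS Q = -1 := by
  rw [← comb_lowestCoord, comb_mem_derivNull_iff hm, comb_lowestCoord, leftDeriv_zero_P hm]
  simp only [Submodule.zero_mem, true_and, lowestCoord, parR]
  rw [eq_neg_iff_add_eq_zero, add_comm]
  have : (-((Q 0 1 : K) * (Q 1 0 : K))) ^ m = (Q 0 1 : K) ^ m * (-(Q 1 0 : K)) ^ m := by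
    rw [← mul_pow, mul_neg]
  rw [this]
  simp only [pow_zero, zero_mul, Nat.zero_div, mul_one]
  constructor <;> intro h <;> linear_combination h

theorem adj_pow_P_mem_U (n k : ℕ) : (adj Q 0 ^ k) (P Q n) ∈ U Q (n + k) := by
  induction k with
  | zero => exact P_mem_U n
  | succ k ih => rw [pow_succ', Module.End.mul_apply]; exact adj_mem_U ih

theorem adj_pow_P_mem_derivNull {n : ℕ} (h : P Q n ∈ derivNull Q) (k : ℕ) :
    (adj Q 0 ^ k) (P Q n) ∈ derivNull Q := by
  induction k with
  | zero => exact h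
  | succ k ih => rw [pow_succ', Module.End.mul_apply]; exact adj_mem_derivNull ih 0

/-- Iterate the commutation relation, starting from a vector killed by the lowering operator. -/
theorem leftDeriv_zero_adj_pow_P {n : ℕ} (hn : normCoef (parQ Q) (parR Q) n ≠ 0) (k : ℕ) :
    leftDeriv Q 0 ((adj Q 0 ^ (k + 1)) (P Q n)) =
      (quantumInt (parQ Q) (k + 1) * (1 - parQ Q ^ (2 * n + k) * parR Q ^ 2)) •
        (adj Q 0 ^ k) (P Q n) := by
  induction k with
  | zero =>
    rw [zero_add, pow_one, leftDeriv_adj_zero, leftDeriv_zero_P hn, map_zero, smul_zero, zero_add,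
      twistOp_twist_of_mem_U (P_mem_U n)]
    simp [sub_smul]
  | succ k ih =>
    rw [pow_succ', Module.End.mul_apply, leftDeriv_adj_zero, ih,
      twistOp_twist_of_mem_U (adj_pow_P_mem_U n (k + 1)), map_smul, ← Module.End.mul_apply,
      ← pow_succ', smul_smul]
    have h1 := quantumInt_succ (parQ Q) (k + 1)
    have h2 := quantumInt_succ' (parQ Q) (k + 1)
    rw [show ∀ (a b : K) (v : TV K (Fin 2)), a • v + (v - b • v) = (a + (1 - b)) • v by
      intros; module]
    congr 1
    linear_combination (-1 : K) * h2 + parQ Q ^ (2 * n + k + 1) * parR Q ^ 2 * h1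

end LinearIndependence

/-! ### The lowest weight ladder over a commutative ring -/

section Ladder

variable {R : Type*} [CommRing R] (q r : R)

/-- The raising operator in rescaled coordinates, with values in degree `m`. -/
def raiseNorm (m : ℕ) (e : ℕ → R) (i : ℕ) : R :=
  q ^ i * r * stepCoef q r (m - i) * e i - stepCoef q r i * e (i - 1)

/-- The lowering operator in rescaled coordinates. -/
def lowerNorm (e : ℕ → R) (i : ℕ) : R := q ^ i * e i - e (i + 1)

/-- The rescaled coordinates of `(ad x_1)^k (P_n)`. -/
def ladder (n : ℕ) : ℕ → ℕ → R
  | 0 => fun i => q ^ (i * (i - 1) / 2)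
  | k + 1 => raiseNorm q r (n + k + 1) (ladder n k)

/-- The solution `e` of `lowerNorm q e = w` with `e 0 = 0`. -/
def lowerSolve (w : ℕ → R) : ℕ → R
  | 0 => 0
  | i + 1 => q ^ i * lowerSolve w i - w i

variable {q r}

/-- Two solutions of the recursion differ by a multiple of the homogeneous solution q^(i(i-1)/2),
the rescaled coordinates of P. -/
theorem lowerSolve_lowerNorm (e : ℕ → R) (i : ℕ) :
    lowerSolve q (lowerNorm q e) i = e i - e 0 * q ^ (i * (i - 1) / 2) := by
  induction i with
  | zero => simp [lowerSolve]
  | succ i ih => rw [lowerSolve, ih, lowerNorm, triangle_succ]; ring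

theorem lowerSolve_congr_mul {w v : ℕ → R} {a : R} {m : ℕ} (h : ∀ i < m, w i = a * v i) :
    lowerSolve q w m = a * lowerSolve q v m := by
  induction m with
  | zero => simp [lowerSolve]
  | succ m ih =>
    rw [lowerSolve, lowerSolve, ih fun i hi => h i (by omega), h m (by omega)]
    ring

theorem raiseNorm_congr_mul {e f : ℕ → R} {a : R} {m : ℕ} (h : ∀ i ≤ m, e i = a * f i) :
    ∀ i ≤ m + 1, raiseNorm q r (m + 1) e i = a * raiseNorm q r (m + 1) f i := by
  intro i hi
  rw [raiseNorm, raiseNorm, h (i - 1) (by omega)]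
  rcases hi.eq_or_lt with rfl | hi
  · simp; ring
  · rw [h i (by omega)]; ring

/-- The same commutation relation, in rescaled coordinates where only q and r occur, so that r may
later become an indeterminate. -/
theorem lowerNorm_raiseNorm {m : ℕ} (e : ℕ → R) {i : ℕ} (hi : i ≤ m) :
    lowerNorm q (raiseNorm q r (m + 1) e) i =
      q * raiseNorm q r m (lowerNorm q e) i + (1 - q ^ (2 * m) * r ^ 2) * e i := by
  obtain ⟨j, rfl⟩ := Nat.exists_eq_add_of_le hi
  have h1 := stepCoef_succ q r i
  have h2 := stepCoef_succ q r j
  simp only [lowerNorm, raiseNorm, Nat.add_sub_cancel, Nat.add_sub_add_right,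
    Nat.add_sub_cancel_left, show i + j + 1 - i = j + 1 by omega]
  cases i with
  | zero =>
    simp only [stepCoef_zero, zero_add, h2] at h1 ⊢
    rw [h1]
    ring
  | succ i =>
    simp only [Nat.add_sub_cancel]
    linear_combination e (i + 1) * h1 + q ^ (2 * (i + 1)) * r * e (i + 1) * h2

theorem lowerNorm_ladder (n k : ℕ) : ∀ i ≤ n + k, lowerNorm q (ladder q r n (k + 1)) i =
    quantumInt q (k + 1) * (1 - q ^ (2 * n + k) * r ^ 2) * ladder q r n k i := by
  induction k with
  | zero =>
    intro i hi
    change lowerNorm q (raiseNorm q r (n + 1) (ladder q r n 0)) i = _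
    rw [lowerNorm_raiseNorm _ hi]
    have h0 : ∀ i, lowerNorm q (ladder q r n 0) i = 0 := by
      intro i; simp only [lowerNorm, ladder, triangle_succ]; ring
    simp [raiseNorm, h0]
  | succ k ih =>
    intro i hi
    rw [ladder, lowerNorm_raiseNorm _ hi, ← Nat.add_assoc, raiseNorm_congr_mul ih i hi]
    rw [show raiseNorm q r (n + k + 1) (ladder q r n k) i = ladder q r n (k + 1) i from rfl]
    have h1 := quantumInt_succ q (k + 1)
    have h2 := quantumInt_succ' q (k + 1)
    linear_combination (ladder q r n (k + 1) i) *
      ((-1 : R) * h2 + q ^ (2 * n + k + 1) * r ^ 2 * h1)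

theorem ladder_apply_zero (n k : ℕ) :
    ladder q r n k 0 = r ^ k * ∏ t ∈ Finset.range k, stepCoef q r (n + t + 1) := by
  induction k with
  | zero => simp [ladder]
  | succ k ih => rw [ladder, raiseNorm, ih, Finset.prod_range_succ]; simp; ring

theorem ladder_apply_top (n k : ℕ) : ladder q r n k (n + k) =
    (-1) ^ k * q ^ (n * (n - 1) / 2) * ∏ t ∈ Finset.range k, stepCoef q r (n + t + 1) := by
  induction k with
  | zero => simp [ladder]
  | succ k ih =>
    rw [ladder, raiseNorm, ← Nat.add_assoc, Nat.add_sub_cancel, ih, Finset.prod_range_succ]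
    simp
    ring

/-- Up to the factor on the left, a preimage of the ladder vector under lowering is the next ladder
vector. Correcting it to start at 0 and reading its top coordinate needs only the extreme
coordinates, where a single term of the raising operator survives. -/
theorem lowerSolve_ladder (n k : ℕ) :
    quantumInt q (k + 1) * (1 - q ^ (2 * n + k) * r ^ 2) *
        lowerSolve q (ladder q r n k) (n + k + 1) =
      (∏ t ∈ Finset.range (k + 1), stepCoef q r (n + t + 1)) *
        ((-1) ^ (k + 1) * q ^ (n * (n - 1) / 2) -
          r ^ (k + 1) * q ^ ((n + k + 1) * (n + k + 1 - 1) / 2)) := by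
  rw [← lowerSolve_congr_mul fun i hi => lowerNorm_ladder n k i (Nat.lt_succ_iff.1 hi),
    lowerSolve_lowerNorm, ladder_apply_zero, Nat.succ_eq_add_one, Nat.add_assoc n k 1,
    ladder_apply_top]
  ring

section Map

variable {S : Type*} [CommRing S] (φ : R →+* S)

theorem map_stepCoef (k : ℕ) : φ (stepCoef q r k) = stepCoef (φ q) (φ r) k := by
  simp [stepCoef, quantumInt]

theorem map_ladder (n k i : ℕ) : φ (ladder q r n k i) = ladder (φ q) (φ r) n k i := by
  induction k generalizing i with
  | zero => simp [ladder]
  | succ k ih => simp [ladder, raiseNorm, ih, map_stepCoef]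

theorem map_lowerSolve (w : ℕ → R) (i : ℕ) :
    φ (lowerSolve q w i) = lowerSolve (φ q) (fun j => φ (w j)) i := by
  induction i with
  | zero => simp [lowerSolve]
  | succ i ih => simp [lowerSolve, ih]

end Map

end Ladder

/-! ### A relation on which lowering after raising vanishes has no preimage -/

section Obstruction

variable {K : Type*} [Field K]

open Polynomial in
-- At such r the identity of `lowerSolve_ladder` reads 0 = 0 and gives no information on the top
-- value. Viewed as a polynomial identity in r, if that value vanished the left side would have a
-- zero of order at least two. On the right the product of step coefficients is nonzero, and the
-- remaining factor has derivative -(k+1) r^k q^e for an exponent e, which is nonzero in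
-- characteristic 0.
theorem lowerSolve_ladder_ne_zero [CharZero K] {q r : K} (hq : q ≠ 0) {n k : ℕ}
    (hm : normCoef q r (n + k + 1) ≠ 0) (h : q ^ (2 * n + k) * r ^ 2 = 1) :
    lowerSolve q (ladder q r n k) (n + k + 1) ≠ 0 := by
  intro h0
  have hr : r ≠ 0 := by rintro rfl; simp at h
  have hA : (∏ t ∈ Finset.range (k + 1), stepCoef q r (n + t + 1)) ≠ 0 :=
    Finset.prod_ne_zero_iff.2 fun t ht => stepCoef_ne_zero hm (by omega)
      (by have := Finset.mem_range.1 ht; omega)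
  have hB := lowerSolve_ladder (q := q) (r := r) n k
  rw [h0, mul_zero] at hB
  have hB := (mul_eq_zero.1 hB.symm).resolve_left hA
  have key := lowerSolve_ladder (q := (C q : K[X])) (r := X) n k
  have hsolve : eval r (lowerSolve (C q : K[X]) (ladder (C q) X n k) (n + k + 1)) = 0 := by
    rw [← coe_evalRingHom, map_lowerSolve]
    simp only [map_ladder]
    simpa using h0
  have hprod : eval r (∏ t ∈ Finset.range (k + 1), stepCoef (C q : K[X]) X (n + t + 1)) =
      ∏ t ∈ Finset.range (k + 1), stepCoef q r (n + t + 1) := by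
    rw [← coe_evalRingHom, map_prod]
    simp [map_stepCoef]
  -- Differentiate at r: on the left both r-dependent factors vanish there, on the right only the
  -- bracket does.
  have hd := congr_arg (fun p => eval r (derivative p)) key
  simp only [derivative_mul, eval_add, eval_mul, hsolve, hprod, mul_zero, zero_add] at hd
  have e1 : eval r (1 - (C q : K[X]) ^ (2 * n + k) * X ^ 2) = 0 := by simp [h]
  have e2 : eval r ((-1) ^ (k + 1) * (C q : K[X]) ^ (n * (n - 1) / 2) -
      X ^ (k + 1) * C q ^ ((n + k + 1) * (n + k + 1 - 1) / 2)) = 0 := by simpa using hB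
  have e3 : eval r (derivative ((-1) ^ (k + 1) * (C q : K[X]) ^ (n * (n - 1) / 2) -
      X ^ (k + 1) * C q ^ ((n + k + 1) * (n + k + 1 - 1) / 2))) =
      -(((k + 1 : ℕ) : K) * r ^ k * q ^ ((n + k + 1) * (n + k + 1 - 1) / 2)) := by
    rw [← C_pow, ← C_pow, ← C_1, ← C_neg, ← C_pow, ← C_mul, derivative_sub, derivative_C,
      derivative_mul, derivative_X_pow, derivative_C]
    simp
  rw [e1, e2, e3] at hd
  simp only [mul_zero, zero_mul, zero_add] at hd
  refine mul_ne_zero hA (neg_ne_zero.2 (mul_ne_zero (mul_ne_zero ?_ (pow_ne_zero _ hr))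
    (pow_ne_zero _ hq))) hd.symm
  exact Nat.cast_ne_zero.2 k.succ_ne_zero

variable {Q : Fin 2 → Fin 2 → Kˣ}

theorem raiseCoord_rescale (m : ℕ) (a : K) (e : ℕ → K) (i : ℕ) :
    raiseCoord Q m (fun i => a * (-(Q 1 0 : K)) ^ i * e i) i =
      a * (Q 1 0 : K)⁻¹ * (-(Q 1 0 : K)) ^ i * raiseNorm (parQ Q) (parR Q) m e i := by
  have h : (Q 1 0 : K) ≠ 0 := Units.ne_zero _
  rw [raiseCoord, raiseNorm]
  cases i with
  | zero => simp [parR]; field_simp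
  | succ i =>
    simp only [Nat.add_sub_cancel, parR, pow_succ]
    field_simp
    ring

theorem adj_pow_P_eq_comb {n k : ℕ} (hm : normCoef (parQ Q) (parR Q) (n + k) ≠ 0) :
    (adj Q 0 ^ k) (P Q n) = comb Q (n + k) (fun i =>
      ((Q 1 0 : K)⁻¹) ^ k * (-(Q 1 0 : K)) ^ i * ladder (parQ Q) (parR Q) n k i) := by
  induction k with
  | zero =>
    simp only [pow_zero, one_mul, Module.End.one_apply, add_zero, ← comb_lowestCoord]
    rfl
  | succ k ih =>
    rw [← Nat.add_assoc] at hm ⊢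
    rw [pow_succ', Module.End.mul_apply, ih (normCoef_ne_zero_of_le hm (Nat.le_succ _)),
      adj_zero_comb hm]
    refine comb_congr fun i _ => ?_
    rw [raiseCoord_rescale, ladder, pow_succ]

/-- A preimage `y` has extreme coordinates satisfying the same linear condition as those of `P`.
Subtracting a multiple of `P` to make the first coordinate 0 forces the last one to be 0, against
`lowerSolve_ladder_ne_zero`. -/
theorem leftDeriv_zero_ne_adj_pow_P [CharZero K] {n k : ℕ}
    (hm : normCoef (parQ Q) (parR Q) (n + k + 1) ≠ 0)
    (h : parQ Q ^ (2 * n + k) * parR Q ^ 2 = 1) (hP : P Q (n + k + 1) ∈ derivNull Q)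
    {y : TV K (Fin 2)} (hyU : y ∈ U Q (n + k + 1)) (hy : y ∈ derivNull Q) :
    leftDeriv Q 0 y ≠ (adj Q 0 ^ k) (P Q n) := by
  intro hF
  obtain ⟨c, rfl⟩ := exists_comb_of_mem_U hm hyU
  have h21 : (Q 1 0 : K) ≠ 0 := Units.ne_zero _
  have hm' := normCoef_ne_zero_of_le hm (Nat.le_succ (n + k))
  rw [leftDeriv_zero_comb hm, adj_pow_P_eq_comb hm'] at hF
  have hF := comb_injective hm' hF
  set e : ℕ → K := fun i => ((-(Q 1 0 : K)) ^ i)⁻¹ * c i with he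
  have hc : ∀ i, c i = (-(Q 1 0 : K)) ^ i * e i := by
    intro i
    simp only [he]
    rw [mul_inv_cancel_left₀ (pow_ne_zero _ (neg_ne_zero.2 h21))]
  have h1 : ∀ i < n + k + 1, lowerNorm (parQ Q) e i =
      ((Q 1 0 : K)⁻¹) ^ (k + 1) * ladder (parQ Q) (parR Q) n k i := by
    intro i hi
    have h2 := hF i (Nat.lt_succ_iff.1 hi)
    rw [lowerCoord, hc, hc, pow_succ] at h2
    refine mul_left_cancel₀ (mul_ne_zero (pow_ne_zero i (neg_ne_zero.2 h21)) h21) ?_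
    rw [lowerNorm, pow_succ]
    field_simp at h2 ⊢
    linear_combination h2
  have h3 := lowerSolve_congr_mul (q := parQ Q) h1
  rw [lowerSolve_lowerNorm] at h3
  have h4 := ((comb_mem_derivNull_iff hm c).1 hy).2
  rw [← comb_lowestCoord] at hP
  have h5 := ((comb_mem_derivNull_iff hm _).1 hP).2
  have hs : parS Q * (Q 0 1 : K) ^ (n + k + 1) ≠ 0 :=
    mul_ne_zero (Units.ne_zero _) (pow_ne_zero _ (Units.ne_zero _))
  refine mul_ne_zero (pow_ne_zero (k + 1) (inv_ne_zero h21))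
    (lowerSolve_ladder_ne_zero (Units.ne_zero _) hm h) (h3.symm.trans ?_)
  refine mul_left_cancel₀ (mul_ne_zero hs (pow_ne_zero (n + k + 1) (neg_ne_zero.2 h21))) ?_
  rw [hc 0, hc (n + k + 1)] at h4
  simp only [lowestCoord, pow_zero, zero_mul, Nat.zero_div, mul_one] at h5
  -- Here `e 0` is the multiple of `P` to be subtracted, since the first coordinate of `P` is 1.
  linear_combination h4 - e 0 * h5

end Obstruction

/-! ### Induction on the degree: independence and spanning -/

section RelationBasis

variable {K : Type*} [Field K] (Q : Fin 2 → Fin 2 → Kˣ)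

/-- The element `(ad x_1)^{m-j} (P_j)`. -/
def relation (m j : ℕ) : TV K (Fin 2) := (adj Q 0 ^ (m - j)) (P Q j)

open Classical in
/-- The finite set `𝕁 ∩ [0, m]`. -/
def relationIndex (m : ℕ) : Finset ℕ :=
  (Finset.range (m + 1)).filter (· ∈ setJ (parQ Q) (parR Q) (parS Q))

/-- The eigenvalue of `∂'_1 ∘ ad x_1` on `relation Q m j`. -/
def relationEigenvalue (m j : ℕ) : K :=
  quantumInt (parQ Q) (m - j + 1) * (1 - parQ Q ^ (2 * j + (m - j)) * parR Q ^ 2)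

variable {Q}

theorem mem_relationIndex {m j : ℕ} :
    j ∈ relationIndex Q m ↔ j ∈ setJ (parQ Q) (parR Q) (parS Q) ∧ j ≤ m := by
  simp [relationIndex, and_comm]

theorem relationIndex_succ_of_mem {m : ℕ}
    (h : m + 1 ∈ setJ (parQ Q) (parR Q) (parS Q)) :
    relationIndex Q (m + 1) = insert (m + 1) (relationIndex Q m) := by
  rw [relationIndex, Finset.range_add_one, Finset.filter_insert, if_pos h]
  rfl

theorem relationIndex_succ_of_notMem {m : ℕ}
    (h : m + 1 ∉ setJ (parQ Q) (parR Q) (parS Q)) :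
    relationIndex Q (m + 1) = relationIndex Q m := by
  rw [relationIndex, Finset.range_add_one, Finset.filter_insert, if_neg h]
  rfl

theorem succ_notMem_relationIndex (m : ℕ) : m + 1 ∉ relationIndex Q m := by
  rw [mem_relationIndex]; omega

theorem relation_self (m : ℕ) : relation Q m m = P Q m := by simp [relation]

theorem relation_succ {m j : ℕ} (h : j ≤ m) :
    relation Q (m + 1) j = adj Q 0 (relation Q m j) := by
  rw [relation, relation, Nat.succ_sub h, pow_succ', Module.End.mul_apply]

theorem relation_mem_U {m j : ℕ} (h : j ≤ m) : relation Q m j ∈ U Q m := by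
  have := adj_pow_P_mem_U (Q := Q) j (m - j)
  rwa [Nat.add_sub_cancel' h] at this

theorem P_mem_derivNull_of_mem_setJ {m : ℕ} (hm : normCoef (parQ Q) (parR Q) m ≠ 0)
    (h : m ∈ setJ (parQ Q) (parR Q) (parS Q)) : P Q m ∈ derivNull Q :=
  (P_mem_derivNull_iff hm).2 ((mem_setJ_iff _ _ _ _).1 h).1

theorem relation_mem {m j : ℕ} (hm : normCoef (parQ Q) (parR Q) m ≠ 0)
    (h : j ∈ relationIndex Q m) : relation Q m j ∈ derivNull Q ⊓ U Q m := by
  obtain ⟨hJ, hj⟩ := mem_relationIndex.1 h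
  exact ⟨adj_pow_P_mem_derivNull
    (P_mem_derivNull_of_mem_setJ (normCoef_ne_zero_of_le hm hj) hJ) _, relation_mem_U hj⟩

theorem leftDeriv_zero_relation {m j : ℕ} (hm : normCoef (parQ Q) (parR Q) m ≠ 0) (h : j ≤ m) :
    leftDeriv Q 0 (relation Q (m + 1) j) = relationEigenvalue Q m j • relation Q m j := by
  rw [relation, Nat.succ_sub h]
  exact leftDeriv_zero_adj_pow_P (normCoef_ne_zero_of_le hm h) _

theorem relationEigenvalue_eq_zero_iff {m j : ℕ}
    (hm : normCoef (parQ Q) (parR Q) (m + 1) ≠ 0) (h : j ≤ m) :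
    relationEigenvalue Q m j = 0 ↔ parQ Q ^ (m + j) * parR Q ^ 2 = 1 := by
  rw [relationEigenvalue, mul_eq_zero,
    or_iff_right (quantumInt_ne_zero hm (Nat.succ_ne_zero _) (by omega)),
    show 2 * j + (m - j) = m + j by omega, sub_eq_zero, eq_comm]

theorem relationEigenvalue_ne_zero_of_mem {m j : ℕ}
    (hm : normCoef (parQ Q) (parR Q) (m + 1) ≠ 0)
    (h : m + 1 ∈ setJ (parQ Q) (parR Q) (parS Q)) (hj : j ∈ relationIndex Q m) :
    relationEigenvalue Q m j ≠ 0 := by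
  obtain ⟨hJ, hjm⟩ := mem_relationIndex.1 hj
  rw [Ne, relationEigenvalue_eq_zero_iff hm hjm]
  have := ((mem_setJ_iff _ _ _ _).1 h).2 j hJ (Nat.lt_succ_of_le hjm)
  rwa [show m + 1 + j - 1 = m + j by omega] at this

theorem relationEigenvalue_zero_unique {m i j : ℕ}
    (hm : normCoef (parQ Q) (parR Q) (m + 1) ≠ 0) (hi : i ∈ relationIndex Q m)
    (hj : j ∈ relationIndex Q m) (hi0 : relationEigenvalue Q m i = 0)
    (hj0 : relationEigenvalue Q m j = 0) : i = j := by
  wlog hij : i < j generalizing i j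
  · rcases lt_trichotomy i j with h | h | h
    · exact this hi hj hi0 hj0 h
    · exact h
    · exact (this hj hi hj0 hi0 h).symm
  obtain ⟨hiJ, him⟩ := mem_relationIndex.1 hi
  obtain ⟨hjJ, hjm⟩ := mem_relationIndex.1 hj
  rw [relationEigenvalue_eq_zero_iff hm him] at hi0
  rw [relationEigenvalue_eq_zero_iff hm hjm] at hj0
  exfalso
  -- Two zero eigenvalues give q^(j-i) = 1. Since (j-i)_q ≠ 0 this forces q = 1, hence r² = 1, which
  -- the definition of 𝕁 excludes for i < j.
  have hq : parQ Q = 1 := by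
    have h1 : quantumInt (parQ Q) (j - i) ≠ 0 := quantumInt_ne_zero hm (by omega) (by omega)
    have h2 : parQ Q ^ (j - i) = 1 := by
      rw [show m + j = (m + i) + (j - i) by omega, pow_add] at hj0
      linear_combination hj0 - parQ Q ^ (j - i) * hi0
    have h3 : quantumInt (parQ Q) (j - i) * (parQ Q - 1) = parQ Q ^ (j - i) - 1 :=
      geom_sum_mul _ _
    rw [h2, sub_self] at h3
    exact sub_eq_zero.1 ((mul_eq_zero.1 h3).resolve_left h1)
  refine ((mem_setJ_iff _ _ _ _).1 hjJ).2 i hiJ hij ?_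
  rw [hq, one_pow] at hi0 ⊢
  exact hi0

/-- The raised relation is killed by lowering, so it is a multiple of `P (m+1)`, and a nonzero one
because raising is injective. Thus `P (m+1)` is a relation already accounted for, which is why 𝕁
leaves m+1 out. -/
theorem P_mem_derivNull_of_relationEigenvalue_eq_zero {m n : ℕ}
    (hm : normCoef (parQ Q) (parR Q) (m + 1) ≠ 0) (hn : n ∈ relationIndex Q m)
    (h0 : relationEigenvalue Q m n = 0) :
    P Q (m + 1) ∈ derivNull Q ∧ ∃ a : K, P Q (m + 1) = a • relation Q (m + 1) n := by
  have hm' := normCoef_ne_zero_of_le hm m.le_succ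
  have hnm := (mem_relationIndex.1 hn).2
  have hmem := relation_mem hm' hn
  have h1 := leftDeriv_zero_relation hm' hnm
  rw [h0, zero_smul] at h1
  obtain ⟨b, hb⟩ := exists_eq_smul_P hm (relation_mem_U (Nat.le_succ_of_le hnm)) h1
  have hne : relation Q m n ≠ 0 := by
    have key : ∀ k, normCoef (parQ Q) (parR Q) (n + k) ≠ 0 → relation Q (n + k) n ≠ 0 := by
      intro k
      induction k with
      | zero => intro hk; rw [add_zero, relation_self]; exact P_ne_zero hk
      | succ k ih =>
        intro hk h
        rw [← Nat.add_assoc] at hk h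
        rw [relation_succ (Nat.le_add_right n k)] at h
        exact ih (normCoef_ne_zero_of_le hk (Nat.le_succ _))
          (adj_zero_injOn_U hk (relation_mem_U (Nat.le_add_right n k)) h)
    have := key (m - n)
    rw [Nat.add_sub_cancel' hnm] at this
    exact this hm'
  have hb0 : b ≠ 0 := by
    rintro rfl
    rw [zero_smul, relation_succ hnm] at hb
    exact hne (adj_zero_injOn_U hm (relation_mem_U hnm) hb)
  have hP : P Q (m + 1) = b⁻¹ • relation Q (m + 1) n := by
    rw [hb, smul_smul, inv_mul_cancel₀ hb0, one_smul]
  refine ⟨?_, b⁻¹, hP⟩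
  rw [hP, relation_succ hnm]
  exact Submodule.smul_mem _ _ (adj_mem_derivNull hmem.1 0)

/-- If m+1 ∈ 𝕁, lowering kills the new vector and scales the others by nonzero eigenvalues.
Otherwise all vectors are raised from degree m, and raising is injective. -/
theorem relation_coeff_eq_zero {m : ℕ} (hm : normCoef (parQ Q) (parR Q) m ≠ 0) {a : ℕ → K}
    (h : ∑ j ∈ relationIndex Q m, a j • relation Q m j = 0) :
    ∀ j ∈ relationIndex Q m, a j = 0 := by
  induction m generalizing a with
  | zero =>
    intro j hj
    obtain ⟨-, hj0⟩ := mem_relationIndex.1 hj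
    obtain rfl := Nat.le_zero.1 hj0
    rw [Finset.sum_eq_single_of_mem 0 hj
      (fun i hi h => absurd (Nat.le_zero.1 (mem_relationIndex.1 hi).2) h), relation_self] at h
    exact (smul_eq_zero.1 h).resolve_right (P_ne_zero hm)
  | succ m ih =>
    have hm' := normCoef_ne_zero_of_le hm m.le_succ
    by_cases hJ : m + 1 ∈ setJ (parQ Q) (parR Q) (parS Q)
    · rw [relationIndex_succ_of_mem hJ, Finset.sum_insert (succ_notMem_relationIndex m),
        relation_self] at h
      have h1 := congr_arg (leftDeriv Q 0) h
      rw [map_add, map_smul, leftDeriv_zero_P hm, smul_zero, zero_add, map_sum, map_zero] at h1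
      have h2 : ∑ j ∈ relationIndex Q m, (a j * relationEigenvalue Q m j) • relation Q m j = 0 := by
        rw [← h1]
        refine Finset.sum_congr rfl fun j hj => ?_
        rw [map_smul, leftDeriv_zero_relation hm' (mem_relationIndex.1 hj).2, smul_smul]
      have h3 : ∀ j ∈ relationIndex Q m, a j = 0 := fun j hj =>
        (mul_eq_zero.1 (ih hm' h2 j hj)).resolve_right
          (relationEigenvalue_ne_zero_of_mem hm hJ hj)
      rw [Finset.sum_eq_zero fun j hj => by rw [h3 j hj, zero_smul], add_zero] at h
      intro j hj
      rw [relationIndex_succ_of_mem hJ, Finset.mem_insert] at hj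
      rcases hj with rfl | hj
      · exact (smul_eq_zero.1 h).resolve_right (P_ne_zero hm)
      · exact h3 j hj
    · rw [relationIndex_succ_of_notMem hJ] at h ⊢
      refine ih hm' (adj_zero_injOn_U hm ?_ ?_)
      · exact Submodule.sum_mem _ fun j hj => Submodule.smul_mem _ _
          (relation_mem_U (mem_relationIndex.1 hj).2)
      · rw [← h, map_sum]
        refine Finset.sum_congr rfl fun j hj => ?_
        rw [map_smul, relation_succ (mem_relationIndex.1 hj).2]

theorem exists_eq_sum_relation [CharZero K] {m : ℕ} (hm : normCoef (parQ Q) (parR Q) m ≠ 0)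
    {y : TV K (Fin 2)} (hyJ : y ∈ derivNull Q) (hyU : y ∈ U Q m) :
    ∃ a : ℕ → K, y = ∑ j ∈ relationIndex Q m, a j • relation Q m j := by
  classical
  induction m generalizing y with
  | zero =>
    obtain ⟨c, rfl⟩ := exists_comb_of_mem_U hm hyU
    have h1 := comb_eq_smul_P hm (leftDeriv_zero_comb_zero (Q := Q) c)
    by_cases hc : c 0 = 0
    · exact ⟨0, by rw [h1, hc]; simp⟩
    · rw [h1] at hyJ
      have hP := (P_mem_derivNull_iff hm).1 ((Submodule.smul_mem_iff _ hc).1 hyJ)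
      have hJ : 0 ∈ relationIndex Q 0 := mem_relationIndex.2
        ⟨(mem_setJ_iff _ _ _ _).2 ⟨hP, fun n _ hn => absurd hn (Nat.not_lt_zero n)⟩, le_rfl⟩
      refine ⟨c, ?_⟩
      rw [Finset.sum_eq_single_of_mem 0 hJ
        (fun i hi h => absurd (Nat.le_zero.1 (mem_relationIndex.1 hi).2) h), relation_self, h1]
  | succ m ih =>
    have hm' := normCoef_ne_zero_of_le hm m.le_succ
    obtain ⟨a, ha⟩ := ih hm' ((mem_derivNull_iff_left.1 hyJ).2 0) (leftDeriv_mem_U hyU)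
    have hmem : ∀ j ∈ relationIndex Q m,
        relation Q (m + 1) j ∈ derivNull Q ⊓ U Q (m + 1) := by
      intro j hj
      rw [relation_succ (mem_relationIndex.1 hj).2]
      exact ⟨adj_mem_derivNull (relation_mem hm' hj).1 0,
        adj_mem_U (relation_mem hm' hj).2⟩
    -- Division by a zero eigenvalue yields 0, so exactly the terms with zero eigenvalue survive in
    -- the image of `z` under lowering.
    set b : ℕ → K := fun j => a j / relationEigenvalue Q m j with hb
    set z := y - ∑ j ∈ relationIndex Q m, b j • relation Q (m + 1) j with hz
    have hzmem : z ∈ derivNull Q ⊓ U Q (m + 1) :=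
      Submodule.sub_mem _ ⟨hyJ, hyU⟩
        (Submodule.sum_mem _ fun j hj => Submodule.smul_mem _ _ (hmem j hj))
    have hyz : y = z + ∑ j ∈ relationIndex Q m, b j • relation Q (m + 1) j := by
      rw [hz, sub_add_cancel]
    have hFz : leftDeriv Q 0 z = ∑ j ∈ relationIndex Q m,
        (if relationEigenvalue Q m j = 0 then a j else 0) • relation Q m j := by
      rw [hz, map_sub, ha, map_sum, ← Finset.sum_sub_distrib]
      refine Finset.sum_congr rfl fun j hj => ?_
      rw [map_smul, leftDeriv_zero_relation hm' (mem_relationIndex.1 hj).2, smul_smul,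
        ← sub_smul]
      congr 1
      simp only [hb]
      split_ifs with h
      · simp [h]
      · field_simp
        simp
    by_cases hex : ∃ n ∈ relationIndex Q m, relationEigenvalue Q m n = 0
    · obtain ⟨n, hn, hn0⟩ := hex
      have hnm := (mem_relationIndex.1 hn).2
      have hJ : m + 1 ∉ setJ (parQ Q) (parR Q) (parS Q) := fun h =>
        relationEigenvalue_ne_zero_of_mem hm h hn hn0
      obtain ⟨hP, d, hd⟩ := P_mem_derivNull_of_relationEigenvalue_eq_zero hm hn hn0
      have hFz' : leftDeriv Q 0 z = a n • relation Q m n := by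
        rw [hFz, Finset.sum_eq_single_of_mem n hn, if_pos hn0]
        intro j hj hjn
        rw [if_neg fun h => hjn (relationEigenvalue_zero_unique hm hj hn h hn0), zero_smul]
      -- Otherwise a multiple of `z` would be a relation mapped by lowering to the basis vector with
      -- zero eigenvalue.
      have han : a n = 0 := by
        by_contra h0
        have hpar := (relationEigenvalue_eq_zero_iff hm hnm).1 hn0
        have hF1 : leftDeriv Q 0 ((a n)⁻¹ • z) = relation Q m n := by
          rw [map_smul, hFz', smul_smul, inv_mul_cancel₀ h0, one_smul]
        obtain ⟨k, rfl⟩ := Nat.exists_eq_add_of_le hnm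
        rw [relation, Nat.add_sub_cancel_left] at hF1
        refine leftDeriv_zero_ne_adj_pow_P hm ?_ hP (Submodule.smul_mem _ _ hzmem.2)
          (Submodule.smul_mem _ _ hzmem.1) hF1
        rw [← hpar]
        congr 2
        omega
      rw [han, zero_smul] at hFz'
      obtain ⟨e, he⟩ := exists_eq_smul_P hm hzmem.2 hFz'
      -- Now `z` is e times `P (m+1)`, which is itself d times the raised n-th relation.
      refine ⟨fun j => (if j = n then e * d else 0) + b j, ?_⟩
      rw [relationIndex_succ_of_notMem hJ]
      simp only [add_smul, Finset.sum_add_distrib, ite_smul, zero_smul, Finset.sum_ite_eq',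
        if_pos hn]
      rw [mul_smul, ← hd, ← he]
      exact hyz
    · push Not at hex
      rw [Finset.sum_eq_zero fun j hj => by rw [if_neg (hex j hj), zero_smul]] at hFz
      obtain ⟨e, he⟩ := exists_eq_smul_P hm hzmem.2 hFz
      by_cases hJ : m + 1 ∈ setJ (parQ Q) (parR Q) (parS Q)
      · refine ⟨fun j => if j = m + 1 then e else b j, ?_⟩
        rw [relationIndex_succ_of_mem hJ, Finset.sum_insert (succ_notMem_relationIndex m)]
        simp only [if_true]
        rw [relation_self, ← he]
        conv_lhs => rw [hyz]
        congr 1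
        refine Finset.sum_congr rfl fun j hj => ?_
        rw [if_neg fun h => succ_notMem_relationIndex m (h ▸ hj)]
      -- With all eigenvalues nonzero, the second condition for m+1 ∈ 𝕁 holds automatically. A
      -- nonzero `e` would give the first one too.
      · have he0 : e = 0 := by
          by_contra h0
          have hz1 := hzmem.1
          rw [he] at hz1
          refine hJ ((mem_setJ_iff _ _ _ _).2 ⟨(P_mem_derivNull_iff hm).1
            ((Submodule.smul_mem_iff _ h0).1 hz1), fun n hn hnm => ?_⟩)
          have hnm := Nat.lt_succ_iff.1 hnm
          have := hex n (mem_relationIndex.2 ⟨hn, hnm⟩)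
          rw [Ne, relationEigenvalue_eq_zero_iff hm hnm] at this
          rwa [show m + 1 + n - 1 = m + n by omega]
        refine ⟨b, ?_⟩
        rw [relationIndex_succ_of_notMem hJ]
        rw [he, he0, zero_smul, zero_add] at hyz
        exact hyz

end RelationBasis

end RankTwoNichols

end

/-! ### Assembly of the basis -/

theorem theorem4p16 {K : Type*} [Field K] [CharZero K] (Q : Fin 2 → Fin 2 → Kˣ) (m : ℕ)
    (hm : RankTwoNichols.qFact (RankTwoNichols.parQ Q) m *
      RankTwoNichols.bCoef (RankTwoNichols.parQ Q) (RankTwoNichols.parR Q) m ≠ 0) :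
    ∃ B : Module.Basis
        {j : ℕ // j ∈ RankTwoNichols.setJ (RankTwoNichols.parQ Q) (RankTwoNichols.parR Q)
          (RankTwoNichols.parS Q) ∧ j ≤ m} K
        ↥(LinearMap.ker (RankTwoNichols.nicholsProj Q).toLinearMap ⊓ RankTwoNichols.U Q m),
      ∀ j, (B j : RankTwoNichols.TV K (Fin 2)) =
        ((RankTwoNichols.adj Q 0) ^ (m - j.1)) (RankTwoNichols.P Q j.1) := by
  open RankTwoNichols in
  have hker := ker_nicholsProj (Q := Q)
  have hm' : normCoef (parQ Q) (parR Q) m ≠ 0 := hm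
  let v : {j : ℕ // j ∈ setJ (parQ Q) (parR Q) (parS Q) ∧ j ≤ m} →
      ↥(LinearMap.ker (nicholsProj Q).toLinearMap ⊓ U Q m) := fun j =>
    ⟨relation Q m j, by rw [hker]; exact relation_mem hm' (mem_relationIndex.2 j.2)⟩
  have hset : {j : ℕ | j ∈ setJ (parQ Q) (parR Q) (parS Q) ∧ j ≤ m} =
      (relationIndex Q m : Set ℕ) := by
    ext j; exact mem_relationIndex.symm
  have hli : LinearIndependent K v := by
    refine LinearIndependent.of_comp (Submodule.subtype _) ?_
    have : LinearIndepOn K (relation Q m)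
        {j : ℕ | j ∈ setJ (parQ Q) (parR Q) (parS Q) ∧ j ≤ m} := by
      rw [hset, linearIndepOn_finset_iff]
      exact fun a ha j hj => relation_coeff_eq_zero hm' ha j hj
    exact this
  have hspan : ⊤ ≤ Submodule.span K (Set.range v) := by
    rintro ⟨y, hy⟩ -
    obtain ⟨a, ha⟩ := exists_eq_sum_relation hm' (hker ▸ hy.1) hy.2
    have hy' : (⟨y, hy⟩ : ↥(LinearMap.ker (nicholsProj Q).toLinearMap ⊓ U Q m)) =
        ∑ j ∈ (relationIndex Q m).attach, a j • v ⟨j, mem_relationIndex.1 j.2⟩ := by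
      apply Subtype.ext
      rw [AddSubmonoidClass.coe_finsetSum]
      change y = ∑ j ∈ (relationIndex Q m).attach, a j • relation Q m j
      rw [Finset.sum_attach _ (fun j => a j • relation Q m j)]
      exact ha
    rw [hy']
    exact Submodule.sum_mem _ fun j _ => Submodule.smul_mem _ _
      (Submodule.subset_span (Set.mem_range_self _))
  exact ⟨Module.Basis.mk hli hspan, fun j => by rw [Module.Basis.mk_apply]; rfl⟩
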